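/- **Notation.** Let $a\ge 1$ be an integer which is either equal to $1$ or is not a perfect power $b^m$ ($m\ge 2$) of a rational number $b$. For $N\ge 1$ let $\mathbb{Q}_a(N)\subset\mathbb{C}$ be the field generated over $\mathbb{Q}$ by all roots of $X^N-a$. For a finite extension $L/K$ of number fields, the discriminant $\mathrm{disc}_{L/K}$ of a finite family $(x_s)$ in $L$ is $\det(\mathrm{Tr}_{L/K}(x_sx_t))_{s,t}$. Let $N=p_1^{e_1}\cdots p_s^{e_s}$ with primes $p_1<\dots<p_s$. For $1\le i\le s$, $1\le t\le e_i$ put $m_{i,t}=p_1^{e_1}\cdots p_{i-1}^{e_{i-1}}p_i^{t}$ and $m_{i,0}=p_1^{e_1}\cdots p_{i-1}^{e_{i-1}}$. If $a>1$, define $$\Delta_a(N)=\Bigl|\mathrm{Nm}_{\mathbb{Q}_a(N)|\mathbb{Q}}\Bigl(\prod_{i=1}^{s}\prod_{t=1}^{e_i}\mathrm{disc}_{\mathbb{Q}_a(m_{i,t})/\mathbb{Q}_a(m_{i,t-1})}\bigl\{\zeta_{p_i^t}^{\,l}\,a^{n/p_i^t}\bigr\}_{l,n}\Bigr)\Bigr|,$$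 where $\zeta_m=e^{2\pi i/m}$, $a^{1/m}>0$, $0\le n<p_i$, and $0\le l<p_i-1$ if $t=1$, $0\le l<p_i$ if $t\ge 2$. If $a=1$, put $\Delta_1(N)=1$. For $\beta\in\mathbb{Q}_a(N)$ let $M_{a,N}(\beta)$ be the least number of summands, counted with repetition, in a representation of $\Delta_a(N)\beta$ as a sum of numbers of the form $\xi\,a^{j/N}$ with $\xi$ a root of unity and $0\le j<N$. For $k>0$ and $c_1>1$ let $g(t)=t\exp\bigl(-k\log t'/\log\log t'\bigr)$ with $t'=t+c_1$. The constant $c_1=c_1(k)$ is fixed so that $\log\log c_1\ge 2$ and $g'(t)\ge 0$, $g''(t)\le 0$ for all $t\ge 0$. **Theorem 4.4.** Let $k>\log 2$, and let $c_1$ be any constant as above. There is a positive number $c_5$, depending only on $k$ (and on the choice of $c_1=c_1(k)$), with the following property. Let $a$ be as above, let $N=pN_1$ with $p\ge c_5$ prime and $p\nmid N_1$, $N_1\ge 1$, let $\zeta$ be a primitive $p$-th root of unity and $\sqrt[p]{a}$ any complex $p$-th root of $a$, and write $\sqrt[p]{a^j}=(\sqrt[p]{a})^j$. Let $$\beta=\sum_{0\le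 i,j\le p-1}a_{ij}\,\zeta^i\sqrt[p]{a^j},\qquad a_{ij}=\alpha_{ij}\,r,$$ where the $\alpha_{ij}$ are algebraic integers in $\mathbb{Q}_a(N_1)$ and $$r=\Bigl|\mathrm{Nm}_{\mathbb{Q}_a(N)|\mathbb{Q}}\bigl(\mathrm{disc}_{\mathbb{Q}_a(N)/\mathbb{Q}_a(N_1)}\{\zeta^i\sqrt[p]{a^j}\}_{0\le i\le p-2,\ 0\le j\le p-1}\bigr)\Bigr|^{-1}\ \text{ if } a>1,\qquad r=1\ \text{ if } a=1$$ (if the discriminant is $0$, that is, if these elements are linearly dependent over $\mathbb{Q}_a(N_1)$, read $r=0$). If $M_{a,N}(\beta)=0$ or $\log M_{a,N}(\beta)\le p(p-1)$, then $$\sum_{0\le i,j,l,m\le p-1} g\bigl(M_{a,N_1}(\alpha_{ij}-\alpha_{lm})\bigr)\ \ge\ 2p(p-1)\,g\bigl(M_{a,N}(\beta)\bigr).$$ -/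

import Mathlib

noncomputable section

/-- The field `ℚ_a(N)`, generated over `ℚ` (inside `ℂ`) by all roots of `X ^ N - a`. -/
def kummerField (a N : ℕ) : IntermediateField ℚ ℂ :=
  IntermediateField.adjoin ℚ {z : ℂ | z ^ N = (a : ℂ)}

theorem kummerField_le {a m N : ℕ} (hN : N ≠ 0) (h : m ∣ N) :
    kummerField a m ≤ kummerField a N := by
  obtain ⟨d, rfl⟩ := h
  have hd : d ≠ 0 := fun h => hN (by simp [h])
  refine IntermediateField.adjoin_le_iff.2 fun z hz => ?_
  obtain ⟨w, rfl⟩ := IsAlgClosed.exists_pow_nat_eq z (Nat.pos_of_ne_zero hd)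
  refine pow_mem (IntermediateField.subset_adjoin ℚ _ ?_) d
  have hz' : (w ^ d) ^ m = (a : ℂ) := hz
  show w ^ (m * d) = (a : ℂ)
  rw [mul_comm, pow_mul, hz']

theorem mem_kummerField_of_pow_eq {a m N : ℕ} (hN : N ≠ 0) (h : m ∣ N) {z : ℂ}
    (hz : z ^ m = (a : ℂ)) : z ∈ kummerField a N :=
  kummerField_le hN h (IntermediateField.subset_adjoin ℚ _ hz)

theorem mem_kummerField_of_pow_eq_one {a m N : ℕ} (ha : a ≠ 0) (hN : N ≠ 0) (h : m ∣ N)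
    {z : ℂ} (hz : z ^ m = 1) : z ∈ kummerField a N := by
  have hm : m ≠ 0 := fun h0 => hN (by simpa [h0] using h)
  obtain ⟨w, hw⟩ := IsAlgClosed.exists_pow_nat_eq (a : ℂ) (Nat.pos_of_ne_zero hm)
  have hw0 : w ≠ 0 := by
    rintro rfl
    rw [zero_pow hm] at hw
    exact ha (by exact_mod_cast hw.symm)
  have h1 := mem_kummerField_of_pow_eq hN h hw
  have h2 : z * w ∈ kummerField a N :=
    mem_kummerField_of_pow_eq hN h (by rw [mul_pow, hz, hw, one_mul])
  have h3 := div_mem h2 h1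
  rwa [mul_div_assoc, div_self hw0, mul_one] at h3

/-- The positive real number `a ^ (j / N)`, as a complex number. -/
def realRoot (a N j : ℕ) : ℂ := (((a : ℝ) ^ ((j : ℝ) / (N : ℝ)) : ℝ) : ℂ)

theorem realRoot_one_pow {a N : ℕ} (hN : N ≠ 0) : realRoot a N 1 ^ N = (a : ℂ) := by
  have h : (((a : ℝ) ^ (((1 : ℕ) : ℝ) / (N : ℝ)) : ℝ)) ^ N = (a : ℝ) := by
    rw [Nat.cast_one, one_div, Real.rpow_inv_natCast_pow (Nat.cast_nonneg a) hN]
  unfold realRoot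
  rw [← Complex.ofReal_pow, h, Complex.ofReal_natCast]

/-- The standard primitive `m`-th root of unity. -/
def stdRoot (m : ℕ) : ℂ := Complex.exp (2 * Real.pi * Complex.I / m)

theorem stdRoot_pow {m : ℕ} (hm : m ≠ 0) : stdRoot m ^ m = 1 :=
  (Complex.isPrimitiveRoot_exp m hm).pow_eq_one

/-- The relative discriminant, for the extension `L / K`, of the family
`z ^ i * w ^ j` with `0 ≤ i < r` and `0 ≤ j < q`. -/
def relDisc (K L : IntermediateField ℚ ℂ) (h : K ≤ L) (r q : ℕ) (z w : L) : K :=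
  Algebra.discr K (fun x : Fin r × Fin q =>
    (⟨((z ^ (x.1 : ℕ) * w ^ (x.2 : ℕ) : L) : ℂ), (z ^ (x.1 : ℕ) * w ^ (x.2 : ℕ)).2⟩ :
      IntermediateField.extendScalars h))

/-- For `N = p₁ ^ e₁ * ⋯ * pₛ ^ eₛ` with `p₁ < ⋯ < pₛ` and `q = pᵢ`, the partial product
`p₁ ^ e₁ * ⋯ * pᵢ₋₁ ^ eᵢ₋₁ * pᵢ ^ t`. -/
def towerIndex (N q t : ℕ) : ℕ :=
  q ^ t * ∏ r ∈ N.primeFactors with r < q, r ^ N.factorization r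

theorem towerIndex_succ (N q t : ℕ) : towerIndex N q (t + 1) = q * towerIndex N q t := by
  unfold towerIndex; ring

theorem towerIndex_dvd {N q t : ℕ} (hq : q ∈ N.primeFactors) (ht : t ≤ N.factorization q) :
    towerIndex N q t ∣ N := by
  have hN : N ≠ 0 := (Nat.mem_primeFactors.1 hq).2.2
  have h1 : q ^ t * ∏ r ∈ N.primeFactors with r < q, r ^ N.factorization r ∣
      q ^ N.factorization q * ∏ r ∈ N.primeFactors with r < q, r ^ N.factorization r :=
    Nat.mul_dvd_mul_right (pow_dvd_pow q ht) _
  have hnot : q ∉ N.primeFactors.filter (fun r => r < q) := by simp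
  rw [← Finset.prod_insert (f := fun r => r ^ N.factorization r) hnot] at h1
  refine h1.trans ?_
  have h2 : (∏ r ∈ N.primeFactors, r ^ N.factorization r) = N :=
    Nat.prod_factorization_pow_eq_self hN
  conv_rhs => rw [← h2]
  refine Finset.prod_dvd_prod_of_subset _ _ _ ?_
  intro x hx
  rcases Finset.mem_insert.1 hx with rfl | hx
  · exact hq
  · exact (Finset.mem_filter.1 hx).1

theorem towerIndex_ne_zero {N q t : ℕ} (hq : q ∈ N.primeFactors)
    (ht : t ≤ N.factorization q) : towerIndex N q t ≠ 0 :=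
  ne_zero_of_dvd_ne_zero (Nat.mem_primeFactors.1 hq).2.2 (towerIndex_dvd hq ht)

theorem pow_dvd_towerIndex (N q t : ℕ) : q ^ t ∣ towerIndex N q t := Dvd.intro _ rfl

theorem towerIndex_dvd_succ (N q t : ℕ) : towerIndex N q t ∣ towerIndex N q (t + 1) :=
  ⟨q, by rw [towerIndex_succ, mul_comm]⟩

/-- The discriminant of one step of the tower: the one of `ℚ_a(⋯ q ^ (t + 1)) / ℚ_a(⋯ q ^ t)`
with respect to the elements `ζ ^ l * b ^ k`, where `ζ` is the standard primitive
`q ^ (t + 1)`-th root of unity, `b` the positive real `q ^ (t + 1)`-th root of `a`,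
`0 ≤ k < q`, and `0 ≤ l < q - 1` if `t = 0` (first power of a new prime), `0 ≤ l < q` otherwise. -/
def stepDisc (a N : ℕ) [NeZero a] (q : N.primeFactors) (t : Fin (N.factorization q)) :
    kummerField a (towerIndex N q t) :=
  relDisc (kummerField a (towerIndex N q t)) (kummerField a (towerIndex N q (t + 1)))
    (kummerField_le (towerIndex_ne_zero q.2 t.2) (towerIndex_dvd_succ N q t))
    (if (t : ℕ) = 0 then (q : ℕ) - 1 else q) q
    ⟨stdRoot ((q : ℕ) ^ ((t : ℕ) + 1)), mem_kummerField_of_pow_eq_one (NeZero.ne a)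
      (towerIndex_ne_zero q.2 t.2) (pow_dvd_towerIndex N q (t + 1))
      (stdRoot_pow (pow_ne_zero _ (Nat.mem_primeFactors.1 q.2).1.ne_zero))⟩
    ⟨realRoot a ((q : ℕ) ^ ((t : ℕ) + 1)) 1, mem_kummerField_of_pow_eq
      (towerIndex_ne_zero q.2 t.2) (pow_dvd_towerIndex N q (t + 1))
      (realRoot_one_pow (pow_ne_zero _ (Nat.mem_primeFactors.1 q.2).1.ne_zero))⟩

/-- The number `Δ_a(N)`: the absolute value of the norm from `ℚ_a(N)` to `ℚ` of the product of
the discriminants of all steps of the tower; for `a = 1` it is replaced by `1`. -/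
def kummerDelta (a N : ℕ) [NeZero a] : ℚ :=
  if a = 1 then 1 else
    |Algebra.norm ℚ (∏ q : N.primeFactors, ∏ t : Fin (N.factorization q),
      IntermediateField.inclusion
        (kummerField_le (Nat.mem_primeFactors.1 q.2).2.2 (towerIndex_dvd q.2 t.2.le))
        (stepDisc a N q t))|

/-- `z` is a root of unity times one of the positive real numbers `a ^ (j / N)`, `0 ≤ j < N`. -/
def IsRootTerm (a N : ℕ) (z : ℂ) : Prop :=
  ∃ (ξ : ℂ) (m j : ℕ), 0 < m ∧ ξ ^ m = 1 ∧ j < N ∧ z = ξ * realRoot a N j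

/-- `M_{a,N}(β)`: the least number of summands, counted with repetition, in a representation
of `Δ_a(N) * β` as a sum of terms `ξ * a ^ (j / N)` with `ξ` a root of unity. -/
def kummerLength (a N : ℕ) [NeZero a] (β : ℂ) : ℕ :=
  sInf {n : ℕ | ∃ z : Fin n → ℂ, (∀ i, IsRootTerm a N (z i)) ∧
    ∑ i, z i = ((kummerDelta a N : ℚ) : ℂ) * β}

/-- The number `r = 1 / |Nm (disc {ζ ^ i * ρ ^ j})|`, where the discriminant is the one of
`ℚ_a(p * N₁) / ℚ_a(N₁)` with respect to `ζ ^ i * ρ ^ j`, `0 ≤ i < p - 1`, `0 ≤ j < p`,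
and the norm is from `ℚ_a(p * N₁)` to `ℚ`; for `a = 1` it is replaced by `1`. -/
def kummerScale (a p N₁ : ℕ) [NeZero a] (hN : p * N₁ ≠ 0) (ζ ρ : ℂ)
    (hζ : IsPrimitiveRoot ζ p) (hρ : ρ ^ p = (a : ℂ)) : ℚ :=
  if a = 1 then 1 else
    1 / |Algebra.norm ℚ (IntermediateField.inclusion
      (kummerField_le (a := a) hN (Dvd.intro_left p rfl))
      (relDisc (kummerField a N₁) (kummerField a (p * N₁))
        (kummerField_le hN (Dvd.intro_left p rfl)) (p - 1) p
        ⟨ζ, mem_kummerField_of_pow_eq_one (NeZero.ne a) hN (Dvd.intro N₁ rfl) hζ.pow_eq_one⟩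
        ⟨ρ, mem_kummerField_of_pow_eq hN (Dvd.intro N₁ rfl) hρ⟩))|

/-- The auxiliary function `g(t) = t * exp (-k * log t' / log (log t'))`, `t' = t + c₁`. -/
def loxtonG (k c₁ t : ℝ) : ℝ :=
  t * Real.exp (-k * Real.log (t + c₁) / Real.log (Real.log (t + c₁)))

/-- The conditions on the constant `c₁` in the definition of `g`: `log log c₁ ≥ 2`, and
`g' ≥ 0`, `g'' ≤ 0` on `[0, ∞)`. -/
def IsLoxtonConst (k c₁ : ℝ) : Prop :=
  1 < c₁ ∧ 2 ≤ Real.log (Real.log c₁) ∧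
    ∀ t : ℝ, 0 ≤ t → 0 ≤ deriv (loxtonG k c₁) t ∧ deriv (deriv (loxtonG k c₁)) t ≤ 0

end

/-!
Suppose first that `a = 1` or `N₁ = 1`. Then `Δ_a(N) * r = 1`, so `M_{a,N}(β)` counts the roots of
unity (times powers of a real `p`-th root of `a`) needed for `∑ α_{ij} ζ^i ρ^j`. Since
`∑ ζ^i ρ^j = 0`, all coefficients may be shifted by a common `α_{lm}`, and hence every row sum of
the integer-valued pseudometric `m = M_{a,N₁}(α_{ij} - α_{lm})` on the `p²` index pairs is at least
`T = M_{a,N}(β)`. Loxton's averaging argument turns this into a bound for `∑ g(m)`: the ratio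
`g(m) / g(T)` is at least `m / T`, and exceeds it by a fixed factor greater than `2` when `m / T` is
small, which is where `k > log 2` enters. Comparing all rows with the one of least sum, either that
sum is already at least `2 g(T)`, or most entries of the row are small, and the triangle inequality
doubles the contribution of the few others.

In the remaining case `M_{a,N}(β)` is `0` or larger than `exp (p * (p - 1))`. Assume that it is not
`0`, so that no discriminant vanishes. The step of the tower at `p` cancels against `r`, while the
step at a prime `q ∣ N₁` has a trace matrix whose determinant is divisible by `4 * a`. Therefore
`Δ_a(N) * r ≥ (4 * a) ^ (p * (p - 1))`. On the other hand, a nonzero algebraic integer has a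
conjugate of absolute value at least `1`, whereas every conjugate of a summand `ξ * a ^ (j / N)` has
absolute value at most `a`; hence `Δ_a(N) * r ≤ a * M_{a,N}(β)`.
-/

section Loxton

open Real

/-- The derivative of `u / log u`, as a function of `L = log u`. It measures the decay of the
exponent `log t' / log log t'` of `loxtonG`, with `u = log t'`. -/
noncomputable def divLogSlope (L : ℝ) : ℝ := 1 / L - 1 / L ^ 2

theorem divLogSlope_nonneg {L : ℝ} (hL : 1 ≤ L) : 0 ≤ divLogSlope L :=
  sub_nonneg.2 (one_div_le_one_div_of_le (by linarith) (by nlinarith))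

theorem antitoneOn_divLogSlope : AntitoneOn divLogSlope (Set.Ici 2) := by
  intro A (hA : 2 ≤ A) L (hL : 2 ≤ L) hAL
  have : 0 < A⁻¹ := by positivity
  have hL2 : L⁻¹ ≤ 2⁻¹ := by gcongr
  have hA2 : A⁻¹ ≤ 2⁻¹ := by gcongr
  have hLA : L⁻¹ ≤ A⁻¹ := by gcongr
  simp only [divLogSlope, one_div, ← inv_pow]
  nlinarith

theorem hasDerivAt_div_log {u : ℝ} (hu : 1 < u) :
    HasDerivAt (fun u => u / log u) (divLogSlope (log u)) u := by
  have hu0 : u ≠ 0 := by linarith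
  have hlog : log u ≠ 0 := (log_pos hu).ne'
  refine ((hasDerivAt_id u).div (hasDerivAt_log hu0) hlog).congr_deriv ?_
  simp only [id, divLogSlope]
  field_simp

theorem sub_mul_divLogSlope_le {v u L : ℝ} (hv : exp 2 ≤ v) (hvu : v ≤ u) (hL : log u ≤ L) :
    (u - v) * divLogSlope L ≤ u / log u - v / log v := by
  have two_le_log : ∀ {w}, v ≤ w → 2 ≤ log w := fun hw =>
    (le_log_iff_exp_le ((exp_pos 2).trans_le (hv.trans hw))).2 (hv.trans hw)
  have hderiv : ∀ {w}, v ≤ w → HasDerivAt (fun u => u / log u) (divLogSlope (log w)) w :=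
    fun hw => hasDerivAt_div_log ((one_lt_exp_iff.2 two_pos).trans_le (hv.trans hw))
  rw [mul_comm]
  refine (convex_Icc v u).mul_sub_le_image_sub_of_le_deriv
    (fun w hw => (hderiv hw.1).continuousAt.continuousWithinAt)
    (fun w hw => (hderiv (interior_subset hw).1).differentiableAt.differentiableWithinAt)
    (fun w hw => ?_) v (Set.left_mem_Icc.2 hvu) u (Set.right_mem_Icc.2 hvu) hvu
  obtain ⟨hvw, hwu⟩ := interior_subset hw
  have hwL : log w ≤ L :=
    (log_le_log ((exp_pos 2).trans_le (hv.trans hvw)) hwu).trans hL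
  rw [(hderiv hvw).deriv]
  exact antitoneOn_divLogSlope (two_le_log hvw) ((two_le_log hvw).trans hwL) hwL

variable {k c : ℝ}

theorem loxtonG_nonneg {t : ℝ} (ht : 0 ≤ t) : 0 ≤ loxtonG k c t :=
  mul_nonneg ht (exp_pos _).le

theorem loxtonG_pos {t : ℝ} (ht : 0 < t) : 0 < loxtonG k c t :=
  mul_pos ht (exp_pos _)

theorem loxtonG_zero : loxtonG k c 0 = 0 := by simp [loxtonG]

theorem exp_two_le_log_add (hc : exp (exp 2) ≤ c) {t : ℝ} (ht : 0 ≤ t) : exp 2 ≤ log (t + c) := by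
  have hc0 : 0 < c := (exp_pos _).trans_le hc
  exact (le_log_iff_exp_le (by positivity)).2 (by linarith)

theorem IsLoxtonConst.exp_exp_two_le (hc : IsLoxtonConst k c) : exp (exp 2) ≤ c := by
  have hc0 : 0 < c := one_pos.trans hc.1
  rw [← le_log_iff_exp_le hc0, ← le_log_iff_exp_le (log_pos hc.1)]
  exact hc.2.1

theorem differentiableAt_loxtonG (hc : exp (exp 2) ≤ c) {t : ℝ} (ht : 0 ≤ t) :
    DifferentiableAt ℝ (loxtonG k c) t := by
  have hc0 : 0 < c := (exp_pos _).trans_le hc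
  have harg : t + c ≠ 0 := by positivity
  have hone : 1 < log (t + c) := (one_lt_exp_iff.2 two_pos).trans_le (exp_two_le_log_add hc ht)
  have hlog : log (t + c) ≠ 0 := by positivity
  have hloglog : log (log (t + c)) ≠ 0 := (log_pos hone).ne'
  unfold loxtonG
  fun_prop (disch := assumption)

theorem IsLoxtonConst.monotoneOn (hc : IsLoxtonConst k c) :
    MonotoneOn (loxtonG k c) (Set.Ici 0) := by
  have hdiff : ∀ t ∈ Set.Ici (0 : ℝ), DifferentiableAt ℝ (loxtonG k c) t :=
    fun t ht => differentiableAt_loxtonG hc.exp_exp_two_le ht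
  exact monotoneOn_of_deriv_nonneg (convex_Ici 0)
    (fun t ht => (hdiff t ht).continuousAt.continuousWithinAt)
    (fun t ht => (hdiff t (interior_subset ht)).differentiableWithinAt)
    (fun t ht => (hc.2.2 t (interior_subset ht)).1)

theorem exp_mul_div_le_loxtonG_div (hk : 0 ≤ k) (hc : exp (exp 2) ≤ c) {m T L : ℝ}
    (hm : 0 ≤ m) (hmT : m ≤ T) (hT : 0 < T) (hL : log (log (T + c)) ≤ L) :
    exp (k * (log ((T + c) / (m + c)) * divLogSlope L)) * (m / T) ≤
      loxtonG k c m / loxtonG k c T := by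
  have hc0 : 0 < c := (exp_pos _).trans_le hc
  have hratio : loxtonG k c m / loxtonG k c T =
      exp (k * (log (T + c) / log (log (T + c)) - log (m + c) / log (log (m + c)))) * (m / T) := by
    rw [loxtonG, loxtonG, mul_div_mul_comm, ← exp_sub, mul_comm]
    ring_nf
  rw [hratio, log_div (by positivity) (by positivity)]
  gcongr
  exact sub_mul_divLogSlope_le (exp_two_le_log_add hc hm)
    (log_le_log (by positivity) (by gcongr)) hL

theorem div_le_loxtonG_div (hk : 0 ≤ k) (hc : exp (exp 2) ≤ c) {m T : ℝ}
    (hm : 0 ≤ m) (hmT : m ≤ T) (hT : 0 < T) : m / T ≤ loxtonG k c m / loxtonG k c T := by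
  have hc0 : 0 < c := (exp_pos _).trans_le hc
  have hlog : exp 2 ≤ log (T + c) := exp_two_le_log_add hc hT.le
  have hL : 2 ≤ log (log (T + c)) := (le_log_iff_exp_le ((exp_pos 2).trans_le hlog)).2 hlog
  refine le_trans ?_ (exp_mul_div_le_loxtonG_div hk hc hm hmT hT le_rfl)
  refine le_mul_of_one_le_left (by positivity) (one_le_exp ?_)
  refine mul_nonneg hk (mul_nonneg (log_nonneg ?_) (divLogSlope_nonneg (by linarith)))
  rw [one_le_div (by positivity)]
  gcongr

theorem loxtonG_add_le (hk : 0 ≤ k) (hc : exp (exp 2) ≤ c) {s t : ℝ} (hs : 0 ≤ s) (ht : 0 ≤ t) :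
    loxtonG k c (s + t) ≤ loxtonG k c s + loxtonG k c t := by
  rcases (add_nonneg hs ht).eq_or_lt with h | h
  · rw [← h, loxtonG_zero]
    exact add_nonneg (loxtonG_nonneg hs) (loxtonG_nonneg ht)
  · have key := add_le_add (div_le_loxtonG_div hk hc hs (by linarith : s ≤ s + t) h)
      (div_le_loxtonG_div hk hc ht (by linarith : t ≤ s + t) h)
    rwa [← add_div, ← add_div, div_self h.ne', one_le_div (loxtonG_pos h)] at key

end Loxton

section Averaging

variable {ι : Type*} [Fintype ι]

theorem card_filter_lt_mul_le_sum {f y : ι → ℝ} (hf : ∀ t, 0 ≤ f t) (hyf : ∀ t, y t ≤ f t)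
    (v : ℝ) : (Finset.card {t | v < y t} : ℝ) * v ≤ ∑ t, f t := by
  rw [← nsmul_eq_mul]
  exact (Finset.card_nsmul_le_sum _ _ _ fun t ht =>
      (Finset.mem_filter.1 ht).2.le.trans (hyf t)).trans
    (Finset.sum_le_univ_sum_of_nonneg hf)

theorem card_filter_lt_le_two_mul {f y : ι → ℝ} {Y : ℝ} (hY : 0 < Y) (hf : ∀ t, 0 ≤ f t)
    (hyf : ∀ t, y t ≤ f t) (hsum : ∑ t, f t ≤ 2) :
    (Finset.card {t | 1 / Y < y t} : ℝ) ≤ 2 * Y := by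
  have := (card_filter_lt_mul_le_sum hf hyf (1 / Y)).trans hsum
  rwa [mul_one_div, div_le_iff₀ hY] at this

-- Rows outside `B` are bounded below by the row of `o`, and rows in `B` through the triangle
-- inequality `d o s - d o t ≤ d s t` for `t ∉ B`.
theorem le_sum_sum_of_forall_row_le [DecidableEq ι] {d : ι → ι → ℝ} (hd : ∀ s t, 0 ≤ d s t)
    (hsymm : ∀ s t, d s t = d t s) (htri : ∀ s t u, d s u ≤ d s t + d t u) {o : ι}
    (ho : ∀ s, ∑ t, d o t ≤ ∑ t, d s t) (B : Finset ι) :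
    2 * ((Fintype.card ι : ℝ) - B.card) * ∑ t ∈ B, d o t +
      ((Fintype.card ι : ℝ) - 2 * B.card) * ∑ t ∈ Bᶜ, d o t ≤ ∑ s, ∑ t, d s t := by
  have hcompl : (Bᶜ.card : ℝ) = Fintype.card ι - B.card := by
    rw [Finset.card_compl, Nat.cast_sub (Finset.card_le_univ B)]
  have houtside : ((Fintype.card ι : ℝ) - B.card) * ∑ t, d o t ≤ ∑ s ∈ Bᶜ, ∑ t, d s t := by
    rw [← hcompl, ← nsmul_eq_mul]
    exact Finset.card_nsmul_le_sum _ _ _ fun s _ => ho s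
  have hinside : ((Fintype.card ι : ℝ) - B.card) * ∑ t ∈ B, d o t - B.card * ∑ t ∈ Bᶜ, d o t ≤
      ∑ s ∈ B, ∑ t, d s t := by
    calc _ = ∑ s ∈ B, ∑ t ∈ Bᶜ, (d o s - d o t) := by
          simp only [Finset.sum_sub_distrib, Finset.sum_const, nsmul_eq_mul, hcompl,
            Finset.mul_sum]
      _ ≤ ∑ s ∈ B, ∑ t ∈ Bᶜ, d s t := by
          gcongr with s _ t _
          linarith [htri o t s, hsymm s t]
      _ ≤ _ := by
          exact Finset.sum_le_sum fun s _ => Finset.sum_le_univ_sum_of_nonneg (hd s)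
  rw [← Finset.sum_add_sum_compl B] at houtside
  rw [← Finset.sum_add_sum_compl B (fun s => ∑ t, d s t)]
  linarith

theorem one_add_mul_sum_le [DecidableEq ι] {f y : ι → ℝ} {r κ : ℝ} (hr : 0 < r)
    (B D : Finset ι) (hDB : D ⊆ B) (hy : 1 ≤ ∑ t, y t) (hyf : ∀ t, y t ≤ f t)
    (hD : ∀ t ∈ D, (1 + κ) * y t ≤ f t) (hB : ∀ t ∉ B, r * y t ≤ f t) :
    1 + κ * ∑ t ∈ D, y t ≤ ∑ t ∈ B, f t + (∑ t ∈ Bᶜ, f t) / r := by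
  have hcompl : ∑ t ∈ Bᶜ, y t ≤ (∑ t ∈ Bᶜ, f t) / r := by
    rw [le_div_iff₀' hr, Finset.mul_sum]
    exact Finset.sum_le_sum fun t ht => hB t (Finset.mem_compl.1 ht)
  have hmid : (1 + κ) * ∑ t ∈ D, y t ≤ ∑ t ∈ D, f t := by
    rw [Finset.mul_sum]
    exact Finset.sum_le_sum hD
  have hrest : ∑ t ∈ B \ D, y t ≤ ∑ t ∈ B \ D, f t := Finset.sum_le_sum fun t _ => hyf t
  rw [← Finset.sum_add_sum_compl B, ← Finset.sum_sdiff hDB] at hy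
  rw [← Finset.sum_sdiff hDB]
  linarith

theorem div_le_sum_filter {f y : ι → ℝ} {Y : ℝ} (hY : 0 < Y) (hf : ∀ t, 0 ≤ f t)
    (hyf : ∀ t, y t ≤ f t) (hsum : ∑ t, f t ≤ 2)
    (hcard : 6 ≤ (Finset.card {t | 1 / Y < y t} : ℝ)) :
    (Finset.card {t | 1 / Y < y t} : ℝ) / (3 * Y) ≤
      ∑ t with 1 / Y < y t ∧ y t ≤ 1 / 2, y t := by
  classical
  have hbig : (Finset.card {t | 1 / 2 < y t} : ℝ) ≤ 4 := by
    linarith [card_filter_lt_mul_le_sum hf hyf (1 / 2)]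
  have hsplit : Finset.card {t | 1 / Y < y t} ≤
      Finset.card {t | 1 / Y < y t ∧ y t ≤ 1 / 2} + Finset.card {t | 1 / 2 < y t} := by
    refine (Finset.card_le_card fun t ht => ?_).trans (Finset.card_union_le _ _)
    simp only [Finset.mem_union, Finset.mem_filter, Finset.mem_univ, true_and] at ht ⊢
    exact (le_or_gt (y t) (1 / 2)).imp (⟨ht, ·⟩) id
  have hmid : (Finset.card {t | 1 / Y < y t} : ℝ) / 3 ≤
      Finset.card {t | 1 / Y < y t ∧ y t ≤ 1 / 2} := by
    have : (Finset.card {t | 1 / Y < y t} : ℝ) ≤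
        Finset.card {t | 1 / Y < y t ∧ y t ≤ 1 / 2} + Finset.card {t | 1 / 2 < y t} := by
      exact_mod_cast hsplit
    linarith
  calc _ = (Finset.card {t | 1 / Y < y t} : ℝ) / 3 * (1 / Y) := by field_simp
    _ ≤ Finset.card {t | 1 / Y < y t ∧ y t ≤ 1 / 2} * (1 / Y) := by gcongr
    _ ≤ _ := by
      rw [← nsmul_eq_mul]
      exact Finset.card_nsmul_le_sum _ _ _ fun t ht => (Finset.mem_filter.1 ht).2.1.le

theorem sub_six_le_mul_one_add_mul_sum {f y : ι → ℝ} {n κ Y : ℝ} (hY : 0 < Y) (hκ : 0 ≤ κ)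
    (hf : ∀ t, 0 ≤ f t) (hyf : ∀ t, y t ≤ f t) (hsum : ∑ t, f t ≤ 2) (hn : 4 * Y ≤ n)
    (hκY : 6 * Y ≤ n * κ) :
    n - 6 ≤ (n - Finset.card {t | 1 / Y < y t}) *
      (1 + κ * ∑ t with 1 / Y < y t ∧ y t ≤ 1 / 2, y t) := by
  set b : ℝ := (Finset.card {t | 1 / Y < y t} : ℝ)
  have hbY : b ≤ 2 * Y := card_filter_lt_le_two_mul hY hf hyf hsum
  have hmid : 0 ≤ ∑ t with 1 / Y < y t ∧ y t ≤ 1 / 2, y t := Finset.sum_nonneg fun t ht =>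
    (by positivity : 0 ≤ 1 / Y).trans (Finset.mem_filter.1 ht).2.1.le
  rcases le_total b 6 with hb6 | hb6
  · nlinarith [mul_nonneg hκ hmid]
  · have hbmid : b / (3 * Y) ≤ ∑ t with 1 / Y < y t ∧ y t ≤ 1 / 2, y t :=
      div_le_sum_filter hY hf hyf hsum hb6
    have hnκ : 3 * Y ≤ (n - b) * κ := by nlinarith
    have hnb : 0 ≤ (n - b) * κ := by linarith
    have : b ≤ (n - b) * κ * ∑ t with 1 / Y < y t ∧ y t ≤ 1 / 2, y t := by
      calc b = 3 * Y * (b / (3 * Y)) := by field_simp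
        _ ≤ _ := by gcongr
    linarith

theorem two_mul_card_sub_six_le_sum_sum {d y : ι → ι → ℝ} {r κ Y : ℝ} (hd : ∀ s t, 0 ≤ d s t)
    (hsymm : ∀ s t, d s t = d t s) (htri : ∀ s t u, d s u ≤ d s t + d t u)
    (hyd : ∀ s t, y s t ≤ d s t) (hsmall : ∀ s t, y s t ≤ 1 / Y → r * y s t ≤ d s t)
    (hmid : ∀ s t, y s t ≤ 1 / 2 → (1 + κ) * y s t ≤ d s t) (hsum : ∀ s, 1 ≤ ∑ t, y s t)
    (hr : 0 < r) (hκ : 0 ≤ κ) (hY : 0 < Y)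
    (hrY : 2 / r * Fintype.card ι ≤ Fintype.card ι - 4 * Y)
    (hκY : 6 * Y ≤ Fintype.card ι * κ) :
    2 * ((Fintype.card ι : ℝ) - 6) ≤ ∑ s, ∑ t, d s t := by
  classical
  rcases isEmpty_or_nonempty ι with hι | hι
  · simp
  obtain ⟨o, ho⟩ := Finite.exists_min fun s => ∑ t, d s t
  rcases le_total 2 (∑ t, d o t) with hbig | hle
  · have := Finset.card_nsmul_le_sum Finset.univ _ 2 fun s _ => hbig.trans (ho s)
    rw [Finset.card_univ, nsmul_eq_mul] at this
    linarith
  set n : ℝ := (Fintype.card ι : ℝ)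
  let B : Finset ι := {t | 1 / Y < y o t}
  let D : Finset ι := {t | 1 / Y < y o t ∧ y o t ≤ 1 / 2}
  have hn : 0 ≤ 2 / r * n := by positivity
  have hbY : (B.card : ℝ) ≤ 2 * Y := card_filter_lt_le_two_mul hY (hd o) (hyd o) hle
  have hnb : 0 ≤ 2 * (n - B.card) := by linarith
  have hgain : n - 6 ≤ (n - B.card) * (1 + κ * ∑ t ∈ D, y o t) :=
    sub_six_le_mul_one_add_mul_sum hY hκ (hd o) (hyd o) hle (by linarith) hκY
  have hrow : 1 + κ * ∑ t ∈ D, y o t ≤ ∑ t ∈ B, d o t + (∑ t ∈ Bᶜ, d o t) / r :=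
    one_add_mul_sum_le hr B D (Finset.monotone_filter_right _ fun _ _ h => h.1) (hsum o) (hyd o)
      (fun t ht => hmid o t (Finset.mem_filter.1 ht).2.2)
      (fun t ht => hsmall o t (not_lt.1 (by simpa [B] using ht)))
  have hcoeff : 2 * (n - B.card) / r ≤ n - 2 * B.card := by
    have : 0 ≤ 2 / r * B.card := by positivity
    linarith [show 2 * (n - B.card) / r = 2 / r * n - 2 / r * B.card by ring]
  calc 2 * (n - 6) ≤ 2 * (n - B.card) * (1 + κ * ∑ t ∈ D, y o t) := by linarith
    _ ≤ 2 * (n - B.card) * (∑ t ∈ B, d o t + (∑ t ∈ Bᶜ, d o t) / r) := by gcongr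
    _ = 2 * (n - B.card) * ∑ t ∈ B, d o t + 2 * (n - B.card) / r * ∑ t ∈ Bᶜ, d o t := by ring
    _ ≤ 2 * (n - B.card) * ∑ t ∈ B, d o t + (n - 2 * B.card) * ∑ t ∈ Bᶜ, d o t := by
      have : 0 ≤ ∑ t ∈ Bᶜ, d o t := Finset.sum_nonneg fun t _ => hd o t
      gcongr
    _ ≤ ∑ s, ∑ t, d s t := le_sum_sum_of_forall_row_le hd hsymm htri ho B

end Averaging

section Parameters

open Real Filter Topology

theorem eventually_rpow_mul_log_add_one_le {θ ε : ℝ} (hθ : θ < 1) (hε : 0 < ε) :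
    ∀ᶠ n : ℝ in atTop, n ^ θ * (log n + 1) ≤ ε * n := by
  have hlog : (fun n : ℝ => log n + 1) =o[atTop] fun n => n ^ (1 - θ) :=
    (isLittleO_log_rpow_atTop (sub_pos.2 hθ)).add
      (Asymptotics.isLittleO_const_left.2 (Or.inr (tendsto_norm_atTop_atTop.comp
        (tendsto_rpow_atTop (sub_pos.2 hθ)))))
  filter_upwards [hlog.def hε, eventually_gt_atTop 0] with n hn hn0
  calc n ^ θ * (log n + 1) ≤ n ^ θ * (ε * n ^ (1 - θ)) := by
        gcongr
        refine (le_norm_self _).trans (hn.trans_eq ?_)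
        rw [norm_of_nonneg (by positivity)]
    _ = ε * n := by
      rw [mul_left_comm, ← rpow_add hn0, add_sub_cancel, rpow_one]

theorem tendsto_mul_divLogSlope (θ C : ℝ) :
    Tendsto (fun L => (θ * (L - 1) - C) * divLogSlope L) atTop (𝓝 θ) := by
  have hlim : Tendsto (fun L : ℝ => (θ - (θ + C) * L⁻¹) * (1 - L⁻¹)) atTop (𝓝 θ) := by
    simpa using (tendsto_const_nhds (x := θ)).sub (tendsto_inv_atTop_zero.const_mul (θ + C)) |>.mul
      ((tendsto_const_nhds (x := (1 : ℝ))).sub tendsto_inv_atTop_zero)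
  refine hlim.congr' ?_
  filter_upwards [eventually_gt_atTop 0] with L hL
  rw [divLogSlope]
  field_simp
  ring

theorem eventually_six_mul_rpow_le {θ ε : ℝ} (hθ : θ < 1) (hε : 0 < ε) :
    ∀ᶠ n : ℝ in atTop, 6 * n ^ θ ≤ n * (ε * divLogSlope (log n + 1)) := by
  filter_upwards [eventually_rpow_mul_log_add_one_le hθ (by positivity : 0 < ε / 12),
    tendsto_log_atTop.eventually_ge_atTop 1, eventually_gt_atTop 0] with n hn hlog hn0
  have hslope : 1 / (2 * (log n + 1)) ≤ divLogSlope (log n + 1) := by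
    rw [divLogSlope, div_sub_div _ _ (by positivity) (by positivity),
      div_le_div_iff₀ (by positivity) (by positivity)]
    nlinarith [mul_nonneg (sq_nonneg (log n + 1)) (sub_nonneg.2 hlog)]
  calc 6 * n ^ θ = 12 * (n ^ θ * (log n + 1)) * (1 / (2 * (log n + 1))) := by
        field_simp
        norm_num
    _ ≤ 12 * (ε / 12 * n) * divLogSlope (log n + 1) := by gcongr
    _ = n * (ε * divLogSlope (log n + 1)) := by ring

theorem eventually_two_div_mul_le {θ r : ℝ} (hθ : θ < 1) (hr : 2 < r) :
    ∀ᶠ n : ℝ in atTop, 2 / r * n ≤ n - 4 * n ^ θ := by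
  have hr' : 0 < 1 - 2 / r := sub_pos.2 ((div_lt_one (by linarith)).2 hr)
  filter_upwards [eventually_rpow_mul_log_add_one_le hθ (by positivity : 0 < (1 - 2 / r) / 4),
    eventually_ge_atTop 1] with n hn hn1
  have : n ^ θ ≤ n ^ θ * (log n + 1) :=
    le_mul_of_one_le_right (by positivity) (by linarith [log_nonneg hn1])
  linarith

theorem eventually_le_mul_divLogSlope {k θ l : ℝ} (hl : l < k * θ) (C : ℝ) :
    ∀ᶠ n : ℝ in atTop, l ≤ k * ((θ * log n - C) * divLogSlope (log n + 1)) := by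
  have hlim := ((tendsto_mul_divLogSlope θ C).const_mul k).eventually_const_le hl
  filter_upwards [(tendsto_log_atTop.atTop_add (tendsto_const_nhds (x := 1))).eventually hlim]
    with n hn
  simpa only [add_sub_cancel_right] using hn

end Parameters

section Metric

open Real Filter

variable {k c : ℝ}

theorem log_log_add_le {T n : ℝ} (hc : exp (exp 2) ≤ c) (hcn : c ≤ n) (hT : 0 < T)
    (hTn : log T ≤ n) : log (log (T + c)) ≤ log n + 1 := by
  have hc0 : 0 < c := (exp_pos _).trans_le hc
  have he : 2 ≤ exp 1 := by linarith [add_one_le_exp (1 : ℝ)]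
  have hn1 : 1 ≤ n := (one_le_exp (exp_pos 2).le).trans (hc.trans hcn)
  have hlog : log (T + c) ≤ n * exp 1 := by
    have hT' : T ≤ exp n := (log_le_iff_le_exp hT).1 hTn
    have hsum : T + c ≤ exp (n + 1) := by
      rw [exp_add]
      nlinarith [add_one_le_exp n, exp_pos n]
    calc log (T + c) ≤ n + 1 := (log_le_iff_le_exp (by positivity)).2 hsum
      _ ≤ n * exp 1 := by nlinarith
  calc log (log (T + c)) ≤ log (n * exp 1) :=
        log_le_log ((exp_pos 2).trans_le (exp_two_le_log_add hc hT.le)) hlog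
    _ = log n + 1 := by rw [log_mul (by linarith) (exp_ne_zero 1), log_exp]

theorem div_le_add_div_add {c m T Y : ℝ} (hc : 0 < c) (hm : 1 ≤ m) (hY : 0 ≤ Y)
    (h : m * Y ≤ T) : Y / (1 + c) ≤ (T + c) / (m + c) := by
  have hYT : Y ≤ T := (le_mul_of_one_le_left hY hm).trans h
  rw [div_le_div_iff₀ (by positivity) (by positivity)]
  nlinarith

theorem exp_mul_div_le_loxtonG_div_of_div_le (hk : 0 ≤ k) (hc : exp (exp 2) ≤ c)
    {m T L Y l : ℝ} (hm : m = 0 ∨ 1 ≤ m) (hmT : m ≤ T) (hT : 0 < T) (hY : 0 < Y)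
    (hL1 : 1 ≤ L) (hL : log (log (T + c)) ≤ L)
    (hl : l ≤ k * ((log Y - log (1 + c)) * divLogSlope L)) (hmY : m / T ≤ 1 / Y) :
    exp l * (m / T) ≤ loxtonG k c m / loxtonG k c T := by
  have hc0 : 0 < c := (exp_pos _).trans_le hc
  rcases hm with rfl | hm
  · simp [loxtonG_zero]
  refine le_trans ?_ (exp_mul_div_le_loxtonG_div hk hc (by positivity) hmT hT hL)
  gcongr
  refine hl.trans ?_
  rw [← log_div hY.ne' (by positivity)]
  have := divLogSlope_nonneg hL1
  gcongr k * (log ?_ * _)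
  exact div_le_add_div_add hc0 hm hY.le (by rwa [div_le_div_iff₀ hT hY, one_mul] at hmY)

theorem one_add_mul_div_le_loxtonG_div (hk : 0 ≤ k) (hc : exp (exp 2) ≤ c) {m T L : ℝ}
    (hm : 0 ≤ m) (hT : 1 ≤ T) (hL1 : 1 ≤ L) (hL : log (log (T + c)) ≤ L)
    (hmT : m / T ≤ 1 / 2) :
    (1 + k * log ((1 + c) / (1 / 2 + c)) * divLogSlope L) * (m / T) ≤
      loxtonG k c m / loxtonG k c T := by
  have hc0 : 0 < c := (exp_pos _).trans_le hc
  have hT0 : 0 < T := by linarith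
  have hmT' : m ≤ T / 2 := by linarith [(div_le_iff₀ hT0).1 hmT]
  have hslope := divLogSlope_nonneg hL1
  refine le_trans ?_ (exp_mul_div_le_loxtonG_div hk hc hm (by linarith) hT0 hL)
  gcongr
  rw [add_comm]
  refine (add_one_le_exp _).trans (exp_le_exp.2 ?_)
  rw [mul_assoc]
  gcongr k * (log ?_ * _)
  rw [div_le_div_iff₀ (by positivity) (by positivity)]
  nlinarith

theorem one_le_sum_min_div {ι : Type*} [Fintype ι] {f : ι → ℝ} {T : ℝ} (hf : ∀ t, 0 ≤ f t)
    (hT : 0 < T) (h : T ≤ ∑ t, f t) : 1 ≤ ∑ t, min (f t) T / T := by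
  rw [← Finset.sum_div, one_le_div hT]
  by_cases hlarge : ∃ t, T ≤ f t
  · obtain ⟨t, ht⟩ := hlarge
    rw [← min_eq_right ht]
    exact Finset.single_le_sum (f := fun t => min (f t) (min (f _) T))
      (fun t _ => le_min (hf t) (le_min (hf _) hT.le)) (Finset.mem_univ t) |>.trans' (by simp)
  · push Not at hlarge
    simpa only [fun t => min_eq_left (hlarge t).le] using h

theorem two_mul_card_sub_six_mul_loxtonG_le {ι : Type*} [Fintype ι] (hk : 0 ≤ k)
    (hc : exp (exp 2) ≤ c) (hmono : MonotoneOn (loxtonG k c) (Set.Ici 0))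
    {m : ι → ι → ℕ} (hsymm : ∀ s t, m s t = m t s) (htri : ∀ s t u, m s u ≤ m s t + m t u)
    {T : ℕ} (hT : 0 < T) (hTm : ∀ s, T ≤ ∑ t, m s t) {l L Y : ℝ} (hY : 0 < Y) (hL1 : 1 ≤ L)
    (hL : log (log (T + c)) ≤ L) (hl : l ≤ k * ((log Y - log (1 + c)) * divLogSlope L))
    (hlY : 2 / exp l * Fintype.card ι ≤ Fintype.card ι - 4 * Y)
    (hκY : 6 * Y ≤ Fintype.card ι * (k * log ((1 + c) / (1 / 2 + c)) * divLogSlope L)) :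
    2 * ((Fintype.card ι : ℝ) - 6) * loxtonG k c T ≤ ∑ s, ∑ t, loxtonG k c (m s t) := by
  classical
  have hc0 : 0 < c := (exp_pos _).trans_le hc
  have hT0 : (0 : ℝ) < T := Nat.cast_pos.2 hT
  have hG : 0 < loxtonG k c T := loxtonG_pos hT0
  have hmin (s t : ι) : 0 ≤ min (m s t : ℝ) T := by positivity
  have hcap (s t : ι) : loxtonG k c (min (m s t : ℝ) T) / loxtonG k c T ≤
      loxtonG k c (m s t) / loxtonG k c T := by
    gcongr
    exact hmono (hmin s t) (Set.mem_Ici.2 (by positivity)) (min_le_left _ _)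
  have hκ : 0 ≤ log ((1 + c) / (1 / 2 + c)) := log_nonneg <| by
    rw [one_le_div (by positivity)]
    linarith
  have hslope := divLogSlope_nonneg hL1
  rw [← le_div_iff₀ hG]
  simp only [Finset.sum_div]
  refine two_mul_card_sub_six_le_sum_sum (y := fun s t => min (m s t : ℝ) T / T) (r := exp l)
    (fun s t => div_nonneg (loxtonG_nonneg (by positivity)) hG.le)
    (fun s t => by rw [hsymm]) (fun s t u => ?_)
    (fun s t => (div_le_loxtonG_div hk hc (hmin s t) (min_le_right _ _) hT0).trans (hcap s t))
    (fun s t h => le_trans (exp_mul_div_le_loxtonG_div_of_div_le hk hc ?_ (min_le_right _ _)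
      hT0 hY hL1 hL hl h) (hcap s t))
    (fun s t h => (one_add_mul_div_le_loxtonG_div hk hc (hmin s t) (Nat.one_le_cast.2 hT)
      hL1 hL h).trans (hcap s t))
    (fun s => one_le_sum_min_div (fun t => Nat.cast_nonneg _) hT0 (mod_cast hTm s))
    (exp_pos l) (by positivity) hY hlY hκY
  · rw [← add_div]
    gcongr
    refine (hmono ?_ ?_ ?_).trans (loxtonG_add_le hk hc (Nat.cast_nonneg _) (Nat.cast_nonneg _))
    · exact Set.mem_Ici.2 (by positivity)
    · exact Set.mem_Ici.2 (by positivity)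
    · exact_mod_cast htri s t u
  · rw [← Nat.cast_min, Nat.cast_eq_zero, Nat.one_le_cast]
    exact Nat.eq_zero_or_pos _

theorem exists_forall_two_mul_card_sub_six_mul_loxtonG_le (hk : log 2 < k)
    (hc : exp (exp 2) ≤ c) (hmono : MonotoneOn (loxtonG k c) (Set.Ici 0)) :
    ∃ n₀ : ℝ, ∀ (ι : Type*) [Fintype ι], n₀ ≤ Fintype.card ι → ∀ m : ι → ι → ℕ,
      (∀ s t, m s t = m t s) → (∀ s t u, m s u ≤ m s t + m t u) →
      ∀ T : ℕ, (∀ s, T ≤ ∑ t, m s t) → log T ≤ Fintype.card ι →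
        2 * ((Fintype.card ι : ℝ) - 6) * loxtonG k c T ≤ ∑ s, ∑ t, loxtonG k c (m s t) := by
  have hc0 : 0 < c := (exp_pos _).trans_le hc
  have hk0 : 0 < k := (log_pos one_lt_two).trans hk
  obtain ⟨l, hl2, hlk⟩ := exists_between hk
  obtain ⟨θ, hθ, hθ1⟩ := exists_between ((div_lt_one hk0).2 hlk)
  have hκ : 0 < k * log ((1 + c) / (1 / 2 + c)) :=
    mul_pos hk0 (log_pos ((one_lt_div (by positivity)).2 (by linarith)))
  obtain ⟨n₀, hn₀⟩ := eventually_atTop.1 <|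
    ((eventually_le_mul_divLogSlope ((div_lt_iff₀' hk0).1 hθ) (log (1 + c))).and
      (eventually_two_div_mul_le hθ1 ((log_lt_iff_lt_exp two_pos).1 hl2))).and
    ((eventually_six_mul_rpow_le hθ1 hκ).and (eventually_ge_atTop c))
  refine ⟨n₀, fun ι _ hι m hsymm htri T hTm hTn => ?_⟩
  obtain ⟨⟨hl, hlY⟩, hκY, hcn⟩ := hn₀ _ hι
  rcases Nat.eq_zero_or_pos T with rfl | hT
  · simpa [loxtonG_zero] using
      Finset.sum_nonneg fun s _ => Finset.sum_nonneg fun t _ => loxtonG_nonneg (Nat.cast_nonneg _)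
  have hn1 : (1 : ℝ) ≤ Fintype.card ι := (one_le_exp (exp_pos 2).le).trans (hc.trans hcn)
  have hn0 : (0 : ℝ) < Fintype.card ι := one_pos.trans_le hn1
  exact two_mul_card_sub_six_mul_loxtonG_le hk0.le hc hmono hsymm htri hT hTm
    (rpow_pos_of_pos hn0 θ) (by linarith [log_nonneg hn1])
    (log_log_add_le hc hcn (Nat.cast_pos.2 hT) hTn)
    (by rwa [log_rpow hn0]) hlY hκY

end Metric

section TraceForm

/-- The coefficient of `z ^ l` in the expansion of `z ^ i` over `1, z, …, z ^ (q - 2)`, where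
`1 + z + ⋯ + z ^ (q - 1) = 0`. -/
def rootCoeff (q i l : ℕ) : ℤ :=
  if i % q = q - 1 then -1 else if i % q = l then 1 else 0

/-- The coefficient of `w ^ n` in the expansion of `w ^ j` over `1, w, …, w ^ (q - 1)`, where
`w ^ q = a`. -/
def radicalCoeff (a q j n : ℕ) : ℤ :=
  if j % q = n then (a : ℤ) ^ (j / q) else 0

/-- The trace of `z ^ i * w ^ j` over a ring on which the elements `z ^ l * w ^ n`, with
`0 ≤ l < q - 1` and `0 ≤ n < q`, form a basis, where `1 + z + ⋯ + z ^ (q - 1) = 0` and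
`w ^ q = a`. -/
def kummerTrace (a q i j : ℕ) : ℤ :=
  (∑ l : Fin (q - 1), rootCoeff q (i + l) l) * ∑ n : Fin q, radicalCoeff a q (j + n) n

/-- The trace form of the elements `z ^ l * w ^ n` of `kummerTrace`. -/
def kummerTraceMatrix (a q : ℕ) : Matrix (Fin (q - 1) × Fin q) (Fin (q - 1) × Fin q) ℤ :=
  Matrix.of fun s t => kummerTrace a q (s.1 + t.1) (s.2 + t.2)

/-- The discriminant of the elements `z ^ l * w ^ n` of `kummerTrace`, when they form a basis. -/
def kummerDisc (a q : ℕ) : ℤ := (kummerTraceMatrix a q).det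

section Expansion

variable {R : Type*} [CommRing R] {a q : ℕ} {z w : R}

theorem pow_eq_sum_rootCoeff (hq : 0 < q) (hz : ∑ i ∈ Finset.range q, z ^ i = 0) (i : ℕ) :
    z ^ i = ∑ l : Fin (q - 1), (rootCoeff q i l : R) * z ^ (l : ℕ) := by
  have hzq : z ^ q = 1 := sub_eq_zero.1 (by rw [← mul_geom_sum, hz, mul_zero])
  rw [pow_eq_pow_mod i hzq]
  unfold rootCoeff
  obtain ⟨r, rfl⟩ : ∃ r, q = r + 1 := ⟨q - 1, by omega⟩
  simp only [Nat.add_sub_cancel]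
  split_ifs with h
  · rw [h, Fin.sum_univ_eq_sum_range (fun l => ((-1 : ℤ) : R) * z ^ l), ← Finset.mul_sum]
    rw [Finset.sum_range_succ] at hz
    push_cast
    linear_combination hz
  · have hlt : i % (r + 1) < r := by
      have := Nat.mod_lt i hq
      omega
    rw [Finset.sum_eq_single ⟨i % (r + 1), hlt⟩ (fun l _ hl => ?_) (by simp)]
    · simp
    · rw [if_neg fun h => hl (Fin.ext h.symm), Int.cast_zero, zero_mul]

theorem pow_eq_sum_radicalCoeff (hq : 0 < q) (hw : w ^ q = a) (j : ℕ) :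
    w ^ j = ∑ n : Fin q, (radicalCoeff a q j n : R) * w ^ (n : ℕ) := by
  unfold radicalCoeff
  rw [Finset.sum_eq_single ⟨j % q, Nat.mod_lt j hq⟩ (fun n _ hn => ?_) (by simp)]
  · simp [← hw, ← pow_mul, ← pow_add, Nat.div_add_mod]
  · rw [if_neg fun h => hn (Fin.ext h.symm), Int.cast_zero, zero_mul]

theorem pow_mul_pow_eq_sum (hq : 0 < q) (hz : ∑ i ∈ Finset.range q, z ^ i = 0)
    (hw : w ^ q = a) (i j : ℕ) :
    z ^ i * w ^ j = ∑ s : Fin (q - 1) × Fin q,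
      ((rootCoeff q i s.1 * radicalCoeff a q j s.2 : ℤ) : R) *
        (z ^ (s.1 : ℕ) * w ^ (s.2 : ℕ)) := by
  rw [pow_eq_sum_rootCoeff hq hz i, pow_eq_sum_radicalCoeff hq hw j, Finset.sum_mul_sum,
    Fintype.sum_prod_type]
  refine Finset.sum_congr rfl fun l _ => Finset.sum_congr rfl fun n _ => ?_
  push_cast
  ring

end Expansion

section Basis

variable {K L : Type*} [CommRing K] [CommRing L] [Algebra K L] {a q : ℕ} {z w : L}
  (b : Module.Basis (Fin (q - 1) × Fin q) K L)

theorem trace_pow_mul_pow (hq : 0 < q) (hz : ∑ i ∈ Finset.range q, z ^ i = 0) (hw : w ^ q = a)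
    (hb : ∀ s, b s = z ^ (s.1 : ℕ) * w ^ (s.2 : ℕ)) (i j : ℕ) :
    Algebra.trace K L (z ^ i * w ^ j) = kummerTrace a q i j := by
  classical
  have hrepr (i j : ℕ) (s : Fin (q - 1) × Fin q) : b.repr (z ^ i * w ^ j) s =
      ((rootCoeff q i s.1 * radicalCoeff a q j s.2 : ℤ) : K) := by
    have : z ^ i * w ^ j =
        ∑ s, ((rootCoeff q i s.1 * radicalCoeff a q j s.2 : ℤ) : K) • b s := by
      simp only [hb, Algebra.smul_def, map_intCast]
      exact pow_mul_pow_eq_sum hq hz hw i j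
    rw [this, b.repr_sum_self]
  rw [Algebra.trace_eq_matrix_trace b, Matrix.trace, kummerTrace, Finset.sum_mul_sum,
    ← Fintype.sum_prod_type' fun (l : Fin (q - 1)) (n : Fin q) =>
      rootCoeff q (i + l) l * radicalCoeff a q (j + n) n, Int.cast_sum]
  refine Finset.sum_congr rfl fun s _ => ?_
  rw [Matrix.diag_apply, Algebra.leftMulMatrix_eq_repr_mul, hb, ← hrepr, mul_mul_mul_comm,
    ← pow_add, ← pow_add]

theorem discr_eq_kummerDisc (hq : 0 < q) (hz : ∑ i ∈ Finset.range q, z ^ i = 0)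
    (hw : w ^ q = a) (hb : ∀ s, b s = z ^ (s.1 : ℕ) * w ^ (s.2 : ℕ)) :
    Algebra.discr K b = kummerDisc a q := by
  rw [Algebra.discr_def, kummerDisc, ← eq_intCast (Int.castRingHom K), RingHom.map_det]
  congr 1
  ext s t
  rw [Algebra.traceMatrix_apply, Algebra.traceForm_apply, hb, hb, mul_mul_mul_comm, ← pow_add,
    ← pow_add, trace_pow_mul_pow b hq hz hw hb]
  rfl

end Basis

section Divisibility

variable {a q : ℕ}

theorem sum_radicalCoeff_add (hq : 0 < q) (j : ℕ) :
    ∑ n : Fin q, radicalCoeff a q (j + n) n = if q ∣ j then (q : ℤ) * (a : ℤ) ^ (j / q) else 0 := by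
  unfold radicalCoeff
  split_ifs with hj
  · obtain ⟨c, rfl⟩ := hj
    have hterm (n : Fin q) : (if (q * c + n) % q = n then (a : ℤ) ^ ((q * c + n) / q) else 0) =
        (a : ℤ) ^ c := by
      rw [Nat.mul_add_mod, Nat.mod_eq_of_lt n.2, if_pos rfl, Nat.mul_add_div hq,
        Nat.div_eq_of_lt n.2, add_zero]
    rw [Finset.sum_congr rfl fun n _ => hterm n]
    simp [Nat.mul_div_cancel_left c hq]
  · refine Finset.sum_eq_zero fun n _ => if_neg fun h => hj ?_
    have hmod : j + n ≡ 0 + n [MOD q] := by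
      rw [Nat.ModEq, h, zero_add, Nat.mod_eq_of_lt n.2]
    exact Nat.modEq_zero_iff_dvd.1 (hmod.add_right_cancel' _)

theorem dvd_kummerTraceMatrix (s t : Fin (q - 1) × Fin q) :
    (q : ℤ) * (if (s.2 : ℕ) = 0 then 1 else (a : ℤ)) ∣ kummerTraceMatrix a q s t := by
  have hq : 0 < q := s.2.pos
  rw [kummerTraceMatrix, Matrix.of_apply, kummerTrace, sum_radicalCoeff_add hq]
  refine Dvd.dvd.mul_left ?_ _
  by_cases hj : q ∣ (s.2 : ℕ) + t.2
  · rw [if_pos hj]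
    refine mul_dvd_mul_left _ ?_
    split_ifs with hs
    · exact one_dvd _
    · refine dvd_pow_self _ (Nat.div_pos (Nat.le_of_dvd (by omega) hj) hq).ne'
  · rw [if_neg hj]
    exact dvd_zero _

theorem prod_dvd_det_of_dvd_row {ι R : Type*} [Fintype ι] [DecidableEq ι] [CommRing R]
    (A : Matrix ι ι R) (v : ι → R) (h : ∀ i j, v i ∣ A i j) : ∏ i, v i ∣ A.det := by
  choose B hB using h
  have hA : A = Matrix.of fun i j => v i * B i j := Matrix.ext hB
  rw [hA]
  exact ⟨_, Matrix.det_mul_column v (Matrix.of B)⟩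

theorem four_mul_le_abs_kummerDisc (ha : 0 < a) (hq : 1 < q) (h : kummerDisc a q ≠ 0) :
    4 * (a : ℤ) ≤ |kummerDisc a q| := by
  let v (s : Fin (q - 1) × Fin q) : ℤ := q * (if (s.2 : ℕ) = 0 then 1 else (a : ℤ))
  have : (1 : ℤ) ≤ a := by exact_mod_cast ha
  have hq' : (2 : ℤ) ≤ q := by exact_mod_cast hq
  have hv (s : Fin (q - 1) × Fin q) : 1 ≤ v s := by
    simp only [v]
    split_ifs <;> nlinarith
  let s₀ : Fin (q - 1) × Fin q := (⟨0, by omega⟩, ⟨0, by omega⟩)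
  let s₁ : Fin (q - 1) × Fin q := (⟨0, by omega⟩, ⟨1, by omega⟩)
  calc 4 * (a : ℤ) ≤ v s₀ * v s₁ := by
        simp only [v, s₀, s₁, if_true, one_ne_zero, if_false, mul_one]
        nlinarith [mul_le_mul hq' hq' (by norm_num) (by linarith)]
    _ = ∏ s ∈ {s₀, s₁}, v s := (Finset.prod_pair (by simp [s₀, s₁])).symm
    _ ≤ ∏ s, v s := Finset.prod_le_prod_of_subset_of_one_le (Finset.subset_univ _)
        (fun s _ => zero_le_one.trans (hv s)) (fun s _ _ => hv s)
    _ ≤ |kummerDisc a q| := Int.le_of_dvd (abs_pos.2 h)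
        ((dvd_abs _ _).2 (prod_dvd_det_of_dvd_row _ v dvd_kummerTraceMatrix))

end Divisibility

end TraceForm

section Step

variable {a m M q : ℕ}

theorem finiteDimensional_kummerField (a : ℕ) {N : ℕ} (hN : N ≠ 0) :
    FiniteDimensional ℚ (kummerField a N) := by
  have hfin : Finite {z : ℂ | z ^ N = (a : ℂ)} :=
    (Polynomial.nthRootsFinset N (a : ℂ)).finite_toSet.subset fun z hz => by
      simpa [Polynomial.mem_nthRootsFinset (Nat.pos_of_ne_zero hN)] using hz
  exact IntermediateField.finiteDimensional_adjoin fun x (hx : x ^ N = a) =>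
    IsIntegral.of_pow (Nat.pos_of_ne_zero hN) (hx ▸ isIntegral_natCast a)

theorem adjoin_pair_le_span {K L : Type*} [CommRing K] [CommRing L] [Algebra K L] {z w : L}
    (hq : 0 < q) (hz : ∑ i ∈ Finset.range q, z ^ i = 0) (hw : w ^ q = a) :
    (Algebra.adjoin K {z, w}).toSubmodule ≤ Submodule.span K
      (Set.range fun s : Fin (q - 1) × Fin q => z ^ (s.1 : ℕ) * w ^ (s.2 : ℕ)) := by
  rw [Algebra.adjoin_eq_span, Submodule.span_le]
  intro x hx
  obtain ⟨i, j, rfl⟩ := (Submonoid.mem_closure_pair _ _ _).1 hx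
  rw [pow_mul_pow_eq_sum hq hz hw]
  refine Submodule.sum_mem _ fun s _ => ?_
  rw [← zsmul_eq_mul]
  exact zsmul_mem (Submodule.subset_span (Set.mem_range_self s)) _

theorem mem_of_pow_mem_of_coprime {K S : Type*} [Field K] [SetLike S K] [SubfieldClass S K]
    {E : S} (h : q.Coprime m) {x : K} (hx : x ≠ 0) (hxq : x ^ q ∈ E) (hxm : x ^ m ∈ E) :
    x ∈ E := by
  have hbezout : (q : ℤ) * Nat.gcdA q m + m * Nat.gcdB q m = 1 := by
    rw [← Nat.gcd_eq_gcd_ab, h.gcd_eq_one, Nat.cast_one]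
  have hx1 : (x ^ q) ^ Nat.gcdA q m * (x ^ m) ^ Nat.gcdB q m = x := by
    rw [← zpow_natCast, ← zpow_natCast, ← zpow_mul, ← zpow_mul, ← zpow_add₀ hx, hbezout, zpow_one]
  rw [← hx1]
  exact mul_mem (zpow_mem hxq _) (zpow_mem hxm _)

theorem kummerField_mul_le_adjoin (ha : a ≠ 0) (hm : m ≠ 0) (hq : q ≠ 0) (hqm : q.Coprime m)
    {z w : ℂ} (hz : IsPrimitiveRoot z q) (hw : w ^ q = a) :
    kummerField a (q * m) ≤
      (IntermediateField.adjoin (kummerField a m) {z, w}).restrictScalars ℚ := by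
  refine IntermediateField.adjoin_le_iff.2 fun x (hx : x ^ (q * m) = a) => ?_
  have ha' : (a : ℂ) ≠ 0 := Nat.cast_ne_zero.2 ha
  have hx0 : x ≠ 0 := (pow_ne_zero_iff (mul_ne_zero hq hm)).1 (hx ▸ ha')
  have hw0 : w ≠ 0 := (pow_ne_zero_iff hq).1 (hw ▸ ha')
  refine mem_of_pow_mem_of_coprime
    (E := IntermediateField.adjoin (kummerField a m) {z, w}) hqm hx0 ?_ ?_
  · have hxq : x ^ q ∈ kummerField a m :=
      mem_kummerField_of_pow_eq hm dvd_rfl (by rw [← pow_mul, hx])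
    exact IntermediateField.algebraMap_mem _ (⟨x ^ q, hxq⟩ : kummerField a m)
  · have hone : (x ^ m / w) ^ q = 1 := by
      rw [div_pow, ← pow_mul, mul_comm m q, hx, hw, div_self ha']
    have : NeZero q := ⟨hq⟩
    obtain ⟨i, -, hi⟩ := hz.eq_pow_of_pow_eq_one hone
    rw [← div_mul_cancel₀ (x ^ m) hw0, ← hi]
    exact mul_mem (pow_mem (IntermediateField.subset_adjoin _ _ (by simp)) i)
      (IntermediateField.subset_adjoin _ _ (by simp))

theorem mem_span_of_mem_kummerField_mul (ha : a ≠ 0) (hm : m ≠ 0) (hq : 1 < q) (hqm : q.Coprime m)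
    {z w : ℂ} (hz : IsPrimitiveRoot z q) (hw : w ^ q = a) {y : ℂ}
    (hy : y ∈ kummerField a (q * m)) :
    y ∈ Submodule.span (kummerField a m)
      (Set.range fun s : Fin (q - 1) × Fin q => z ^ (s.1 : ℕ) * w ^ (s.2 : ℕ)) := by
  have hq0 : 0 < q := zero_lt_one.trans hq
  refine adjoin_pair_le_span (K := kummerField a m) hq0 (hz.geom_sum_eq_zero hq) hw ?_
  have halg : ∀ x ∈ ({z, w} : Set ℂ), IsAlgebraic (kummerField a m) x := by
    rintro x (rfl | rfl)
    · exact (hz.isIntegral hq0).tower_top.isAlgebraic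
    · exact (IsIntegral.of_pow hq0 (hw ▸ isIntegral_natCast a)).isAlgebraic
  rw [Subalgebra.mem_toSubmodule, ← IntermediateField.adjoin_toSubalgebra_of_isAlgebraic halg]
  exact kummerField_mul_le_adjoin ha hm hq0.ne' hqm hz hw hy

theorem relDisc_eq_kummerDisc (ha : a ≠ 0) (hm : m ≠ 0) (hq : 1 < q) (hqm : q.Coprime m)
    (hM : M = q * m) (h : kummerField a m ≤ kummerField a M) {z w : kummerField a M}
    (hz : IsPrimitiveRoot (z : ℂ) q) (hw : (w : ℂ) ^ q = a)
    (hne : relDisc (kummerField a m) (kummerField a M) h (q - 1) q z w ≠ 0) :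
    relDisc (kummerField a m) (kummerField a M) h (q - 1) q z w = kummerDisc a q := by
  subst hM
  let z' : IntermediateField.extendScalars h := ⟨z, z.2⟩
  let w' : IntermediateField.extendScalars h := ⟨w, w.2⟩
  let v (s : Fin (q - 1) × Fin q) : IntermediateField.extendScalars h :=
    z' ^ (s.1 : ℕ) * w' ^ (s.2 : ℕ)
  have hrel : relDisc (kummerField a m) (kummerField a (q * m)) h (q - 1) q z w =
      Algebra.discr (kummerField a m) v := rfl
  rw [hrel] at hne ⊢
  have hindep : LinearIndependent (kummerField a m) v := by
    by_contra hdep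
    exact hne (Algebra.discr_zero_of_not_linearIndependent _ hdep)
  have hspan : ⊤ ≤ Submodule.span (kummerField a m) (Set.range v) := by
    intro y _
    have hy := mem_span_of_mem_kummerField_mul ha hm hq hqm hz hw y.2
    have hcomp : (fun s : Fin (q - 1) × Fin q => (z : ℂ) ^ (s.1 : ℕ) * (w : ℂ) ^ (s.2 : ℕ)) =
        (IntermediateField.extendScalars h).val.toLinearMap ∘ v := by
      ext s
      simp [v, z', w']
    rw [hcomp, Set.range_comp, ← Submodule.map_span] at hy
    obtain ⟨y', hy', hyy'⟩ := hy
    rwa [← Subtype.ext hyy']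
  have hz' : IsPrimitiveRoot z' q := IsPrimitiveRoot.of_map_of_injective
    (f := (IntermediateField.extendScalars h).val) hz Subtype.val_injective
  rw [← Module.Basis.coe_mk hindep hspan]
  exact discr_eq_kummerDisc _ (by omega) (hz'.geom_sum_eq_zero hq)
    (Subtype.ext (by simpa using hw)) fun s => Module.Basis.mk_apply ..

theorem mul_le_finrank_of_relDisc_ne_zero {K L : IntermediateField ℚ ℂ}
    [FiniteDimensional ℚ L] (h : K ≤ L) {r q : ℕ} {z w : L} (hne : relDisc K L h r q z w ≠ 0) :
    r * q ≤ Module.finrank ℚ L := by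
  unfold relDisc at hne
  have hK : LinearIndependent K fun x : Fin r × Fin q =>
      (⟨((z ^ (x.1 : ℕ) * w ^ (x.2 : ℕ) : L) : ℂ), (z ^ (x.1 : ℕ) * w ^ (x.2 : ℕ)).2⟩ :
        IntermediateField.extendScalars h) := by
    by_contra hdep
    exact hne (Algebra.discr_zero_of_not_linearIndependent K hdep)
  have hℂ := hK.map' (IntermediateField.extendScalars h).val.toLinearMap
    (LinearMap.ker_eq_bot.2 Subtype.val_injective)
  have hℚ : LinearIndependent ℚ fun x : Fin r × Fin q =>
      ((z ^ (x.1 : ℕ) * w ^ (x.2 : ℕ) : L) : ℂ) :=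
    hℂ.restrict_scalars fun x y hxy => by simpa [Algebra.smul_def] using hxy
  have hL : LinearIndependent ℚ fun x : Fin r × Fin q => z ^ (x.1 : ℕ) * w ^ (x.2 : ℕ) :=
    LinearIndependent.of_comp L.val.toLinearMap hℚ
  simpa using hL.fintype_card_le_finrank

theorem isIntegral_relDisc {K L : IntermediateField ℚ ℂ} [FiniteDimensional ℚ L] (h : K ≤ L)
    {r q : ℕ} {z w : L} (hz : IsIntegral ℤ z) (hw : IsIntegral ℤ w) :
    IsIntegral ℤ (relDisc K L h r q z w) := by
  have : FiniteDimensional ℚ (IntermediateField.extendScalars h) := ‹FiniteDimensional ℚ L›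
  have : FiniteDimensional K (IntermediateField.extendScalars h) :=
    FiniteDimensional.right ℚ K (IntermediateField.extendScalars h)
  refine Algebra.discr_isIntegral K fun s => ?_
  have hs : IsIntegral ℤ ((z ^ (s.1 : ℕ) * w ^ (s.2 : ℕ) : L) : ℂ) :=
    ((hz.pow _).mul (hw.pow _)).map (IsScalarTower.toAlgHom ℤ L ℂ)
  exact (isIntegral_algHom_iff (IsScalarTower.toAlgHom ℤ (IntermediateField.extendScalars h) ℂ)
    Subtype.val_injective).1 hs

end Step

section RootTerm

theorem realRoot_pow (a : ℕ) {N : ℕ} (hN : N ≠ 0) (j : ℕ) : realRoot a N j ^ N = (a : ℂ) ^ j := by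
  rw [realRoot, ← Complex.ofReal_pow, ← Real.rpow_mul_natCast a.cast_nonneg,
    div_mul_cancel₀ _ (Nat.cast_ne_zero.2 hN), Real.rpow_natCast, Complex.ofReal_pow,
    Complex.ofReal_natCast]

theorem isRootTerm_iff {a N : ℕ} (ha : a ≠ 0) {z : ℂ} :
    IsRootTerm a N z ↔ ∃ m j : ℕ, 0 < m ∧ j < N ∧ z ^ (N * m) = (a : ℂ) ^ (j * m) := by
  constructor
  · rintro ⟨ξ, m, j, hm, hξ, hj, rfl⟩
    refine ⟨m, j, hm, hj, ?_⟩
    rw [mul_pow, mul_comm N m, pow_mul, hξ, one_pow, one_mul, mul_comm m N, pow_mul,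
      realRoot_pow a (by omega), pow_mul]
  · rintro ⟨m, j, hm, hj, h⟩
    have hN : N ≠ 0 := by omega
    have hroot : realRoot a N j ^ (N * m) = (a : ℂ) ^ (j * m) := by
      rw [pow_mul, realRoot_pow a hN, pow_mul]
    have hne : realRoot a N j ^ (N * m) ≠ 0 :=
      hroot ▸ pow_ne_zero _ (Nat.cast_ne_zero.2 ha)
    refine ⟨z / realRoot a N j, N * m, j, by positivity, ?_, hj, ?_⟩
    · rw [div_pow, h, ← hroot, div_self hne]
    · rw [div_mul_cancel₀ _ ((pow_ne_zero_iff (by positivity)).1 hne)]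

theorem isRootTerm_of_pow_eq_one {a N m : ℕ} (hN : N ≠ 0) (hm : 0 < m) {z : ℂ}
    (hz : z ^ m = 1) : IsRootTerm a N z :=
  ⟨z, m, 0, hm, hz, Nat.pos_of_ne_zero hN, by simp [realRoot]⟩

theorem IsRootTerm.neg {a N : ℕ} {z : ℂ} (h : IsRootTerm a N z) : IsRootTerm a N (-z) := by
  obtain ⟨ξ, m, j, hm, hξ, hj, rfl⟩ := h
  refine ⟨-ξ, 2 * m, j, by omega, ?_, hj, by ring⟩
  rw [pow_mul, neg_sq, ← pow_mul, mul_comm, pow_mul, hξ, one_pow]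

/-- `x` is a sum of `n` numbers of the form root of unity times `a ^ (j / N)`, so that
`kummerLength a N β` is the least `n` with `IsRootSum a N n (kummerDelta a N * β)`. -/
def IsRootSum (a N n : ℕ) (x : ℂ) : Prop :=
  ∃ z : Fin n → ℂ, (∀ i, IsRootTerm a N (z i)) ∧ ∑ i, z i = x

namespace IsRootSum

variable {a N n n' : ℕ} {x y : ℂ}

theorem of_fintype {ι : Type*} [Fintype ι] (z : ι → ℂ) (hz : ∀ i, IsRootTerm a N (z i)) :
    IsRootSum a N (Fintype.card ι) (∑ i, z i) :=
  ⟨fun i => z ((Fintype.equivFin ι).symm i), fun _ => hz _,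
    Equiv.sum_comp (Fintype.equivFin ι).symm z⟩

theorem zero : IsRootSum a N 0 0 := ⟨Fin.elim0, fun i => i.elim0, by simp⟩

theorem sum {ι : Type*} [Fintype ι] {n : ι → ℕ} {x : ι → ℂ}
    (h : ∀ i, IsRootSum a N (n i) (x i)) : IsRootSum a N (∑ i, n i) (∑ i, x i) := by
  choose z hz hsum using h
  have hsigma := of_fintype (a := a) (N := N) (fun s : Σ i, Fin (n i) => z s.1 s.2)
    fun s => hz s.1 s.2
  rw [Fintype.sum_sigma] at hsigma
  simpa [hsum] using hsigma

theorem add (hx : IsRootSum a N n x) (hy : IsRootSum a N n' y) :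
    IsRootSum a N (n + n') (x + y) := by
  simpa using sum (a := a) (N := N) (n := ![n, n']) (x := ![x, y])
    fun i => by fin_cases i <;> simpa

theorem mul {N' : ℕ} {w : ℂ} (hx : IsRootSum a N n x)
    (h : ∀ z, IsRootTerm a N z → IsRootTerm a N' (z * w)) : IsRootSum a N' n (x * w) := by
  obtain ⟨z, hz, rfl⟩ := hx
  exact ⟨fun i => z i * w, fun i => h _ (hz i), by rw [Finset.sum_mul]⟩

theorem neg (hx : IsRootSum a N n x) : IsRootSum a N n (-x) := by
  simpa using hx.mul (w := -1) fun z hz => by simpa using hz.neg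

end IsRootSum

theorem exists_isRootSum_of_mem_span {a N : ℕ} {x : ℂ}
    (hx : x ∈ Submodule.span ℤ {z | IsRootTerm a N z}) : ∃ n, IsRootSum a N n x := by
  rw [← Submodule.mem_toAddSubgroup, Submodule.span_int_eq_addSubgroupClosure] at hx
  induction hx using AddSubgroup.closure_induction with
  | mem z hz => exact ⟨1, fun _ => z, fun _ => hz, by simp⟩
  | zero => exact ⟨0, .zero⟩
  | add y z _ _ hy hz =>
    obtain ⟨n, hn⟩ := hy
    obtain ⟨n', hn'⟩ := hz
    exact ⟨n + n', hn.add hn'⟩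
  | neg y _ hy =>
    obtain ⟨n, hn⟩ := hy
    exact ⟨n, hn.neg⟩

end RootTerm

section Length

variable {a N : ℕ} [NeZero a] {β γ : ℂ}

theorem kummerLength_le {n : ℕ} (h : IsRootSum a N n ((kummerDelta a N : ℚ) * β)) :
    kummerLength a N β ≤ n := Nat.sInf_le h

theorem isRootSum_kummerLength
    (h : ((kummerDelta a N : ℚ) : ℂ) * β ∈ Submodule.span ℤ {z | IsRootTerm a N z}) :
    IsRootSum a N (kummerLength a N β) ((kummerDelta a N : ℚ) * β) :=
  Nat.sInf_mem (s := {n | IsRootSum a N n ((kummerDelta a N : ℚ) * β)})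
    (exists_isRootSum_of_mem_span h)

theorem isRootSum_of_kummerLength_ne_zero (h : kummerLength a N β ≠ 0) :
    IsRootSum a N (kummerLength a N β) ((kummerDelta a N : ℚ) * β) :=
  Nat.sInf_mem (s := {n | IsRootSum a N n ((kummerDelta a N : ℚ) * β)})
    (Nat.nonempty_of_pos_sInf (Nat.pos_of_ne_zero h))

theorem mul_ne_zero_of_kummerLength_ne_zero (h : kummerLength a N β ≠ 0) :
    ((kummerDelta a N : ℚ) : ℂ) * β ≠ 0 := fun h0 =>
  h (Nat.le_zero.1 (kummerLength_le (h0 ▸ IsRootSum.zero)))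

theorem kummerLength_neg (β : ℂ) : kummerLength a N (-β) = kummerLength a N β := by
  have hiff (n : ℕ) : IsRootSum a N n ((kummerDelta a N : ℚ) * -β) ↔
      IsRootSum a N n ((kummerDelta a N : ℚ) * β) :=
    ⟨fun h => by simpa using h.neg, fun h => by simpa using h.neg⟩
  exact congrArg sInf (Set.ext hiff)

theorem kummerLength_sub_comm (β γ : ℂ) :
    kummerLength a N (β - γ) = kummerLength a N (γ - β) := by
  rw [← kummerLength_neg, neg_sub]

theorem kummerLength_add_le
    (hβ : ((kummerDelta a N : ℚ) : ℂ) * β ∈ Submodule.span ℤ {z | IsRootTerm a N z})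
    (hγ : ((kummerDelta a N : ℚ) : ℂ) * γ ∈ Submodule.span ℤ {z | IsRootTerm a N z}) :
    kummerLength a N (β + γ) ≤ kummerLength a N β + kummerLength a N γ :=
  kummerLength_le <| by
    rw [mul_add]
    exact (isRootSum_kummerLength hβ).add (isRootSum_kummerLength hγ)

theorem kummerLength_le_sum_sub {N' : ℕ} {ι : Type*} [Fintype ι] {x w : ι → ℂ}
    (hx : ∀ s, ((kummerDelta a N : ℚ) : ℂ) * x s ∈ Submodule.span ℤ {z | IsRootTerm a N z})
    (hw : ∀ s z, IsRootTerm a N z → IsRootTerm a N' (z * w s)) (hw0 : ∑ s, w s = 0)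
    (hβ : ((kummerDelta a N' : ℚ) : ℂ) * β = (kummerDelta a N : ℚ) * ∑ s, x s * w s) (s : ι) :
    kummerLength a N' β ≤ ∑ t, kummerLength a N (x s - x t) := by
  refine kummerLength_le ?_
  have hshift : ∑ t, x t * w t = ∑ t, (x t - x s) * w t := by
    simp only [sub_mul, Finset.sum_sub_distrib, ← Finset.mul_sum, hw0, mul_zero, sub_zero]
  rw [hβ, hshift, Finset.mul_sum]
  refine IsRootSum.sum fun t => ?_
  rw [kummerLength_sub_comm, ← mul_assoc]
  exact (isRootSum_kummerLength (by rw [mul_sub]; exact sub_mem (hx t) (hx s))).mul (hw t)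

end Length

section Cyclotomic

theorem kummerField_one_right (a : ℕ) : kummerField a 1 = ⊥ :=
  le_bot_iff.1 <| IntermediateField.adjoin_le_iff.2 fun z hz => by
    have hza : z = a := by simpa using hz
    exact hza ▸ natCast_mem (⊥ : IntermediateField ℚ ℂ) a

theorem isCyclotomicExtension_kummerField_one_left (N : ℕ) [NeZero N] :
    IsCyclotomicExtension {N} ℚ (kummerField 1 N) := by
  have hζ : IsPrimitiveRoot (stdRoot N) N := Complex.isPrimitiveRoot_exp N (NeZero.ne N)
  refine (IntermediateField.isCyclotomicExtension_singleton_iff_eq_adjoin N ℚ ℂ _ hζ).2 ?_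
  refine le_antisymm (IntermediateField.adjoin_le_iff.2 fun z hz => ?_)
    (IntermediateField.adjoin_le_iff.2 ?_)
  · obtain ⟨i, -, rfl⟩ := hζ.eq_pow_of_pow_eq_one (ξ := z) (by simpa using hz)
    exact pow_mem (IntermediateField.mem_adjoin_simple_self ℚ _) i
  · rintro _ rfl
    exact mem_kummerField_of_pow_eq_one one_ne_zero (NeZero.ne N) dvd_rfl hζ.pow_eq_one

theorem mem_span_of_mem_kummerField_one_left {N : ℕ} (hN : N ≠ 0) {x : ℂ}
    (hx : x ∈ kummerField 1 N) (hint : IsIntegral ℤ x) :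
    x ∈ Submodule.span ℤ {z : ℂ | z ^ N = 1} := by
  have : NeZero N := ⟨hN⟩
  have := isCyclotomicExtension_kummerField_one_left N
  have hζ : IsPrimitiveRoot (stdRoot N) N := Complex.isPrimitiveRoot_exp N hN
  let ζ : kummerField 1 N :=
    ⟨stdRoot N, mem_kummerField_of_pow_eq_one one_ne_zero hN dvd_rfl hζ.pow_eq_one⟩
  have hcl := IsCyclotomicExtension.Rat.isIntegralClosure_adjoin_singleton
    (IsPrimitiveRoot.of_map_of_injective (ζ := ζ) (f := (kummerField 1 N).val) hζ
      Subtype.val_injective)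
  let φ := IsScalarTower.toAlgHom ℤ (kummerField 1 N) ℂ
  obtain ⟨y, hy⟩ := hcl.isIntegral_iff.1
    ((isIntegral_algHom_iff φ Subtype.val_injective (x := ⟨x, hx⟩)).1 hint)
  have hxmem : x ∈ Algebra.adjoin ℤ {stdRoot N} := by
    have hmap := Subalgebra.mem_map.2 ⟨_, y.2, congrArg φ hy⟩
    rwa [AlgHom.map_adjoin, Set.image_singleton] at hmap
  rw [← Subalgebra.mem_toSubmodule, Algebra.adjoin_eq_span] at hxmem
  refine Submodule.span_mono ?_ hxmem
  intro z hz
  obtain ⟨i, rfl⟩ := Submonoid.mem_closure_singleton.1 hz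
  exact (pow_right_comm _ _ _).trans (by rw [hζ.pow_eq_one, one_pow])

theorem mem_span_isRootTerm_of_isIntegral {a N : ℕ} (h : a = 1 ∨ N = 1) (hN : N ≠ 0) {x : ℂ}
    (hx : x ∈ kummerField a N) (hint : IsIntegral ℤ x) :
    x ∈ Submodule.span ℤ {z | IsRootTerm a N z} := by
  have hx1 : x ∈ kummerField 1 N := by
    rcases h with rfl | rfl
    · exact hx
    · rwa [kummerField_one_right] at hx ⊢
  exact Submodule.span_mono (fun z => isRootTerm_of_pow_eq_one hN (Nat.pos_of_ne_zero hN))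
    (mem_span_of_mem_kummerField_one_left hN hx1 hint)

end Cyclotomic

section Conjugates

theorem norm_map_le_of_pow_eq_pow {R : Type*} [Semiring R] (σ : R →+* ℂ) {a n j : ℕ}
    (ha : a ≠ 0) (hn : n ≠ 0) (hj : j ≤ n) {y : R} (hy : y ^ n = (a : R) ^ j) : ‖σ y‖ ≤ a := by
  refine le_of_pow_le_pow_left₀ hn a.cast_nonneg ?_
  calc ‖σ y‖ ^ n = (a : ℝ) ^ j := by
        rw [← norm_pow, ← map_pow, hy, map_pow, map_natCast, norm_pow, Complex.norm_natCast]
    _ ≤ (a : ℝ) ^ n := pow_le_pow_right₀ (Nat.one_le_cast.2 (Nat.one_le_iff_ne_zero.2 ha)) hj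

theorem le_card_mul_of_sum_eq_mul {K ι : Type*} [Field K] [NumberField K] [Fintype ι] {B : ℝ}
    {D : ℚ} (hD : 0 ≤ D) {x : K} (hx : x ≠ 0) (hint : IsIntegral ℤ x) {y : ι → K}
    (hy : ∀ i, ∀ σ : K →+* ℂ, ‖σ (y i)‖ ≤ B) (hsum : ∑ i, y i = D * x) :
    (D : ℝ) ≤ Fintype.card ι * B := by
  obtain ⟨σ, hσ⟩ := NumberField.exists_conjugate_one_le_norm (K := K) (α := ⟨x, hint⟩)
    fun h => hx (congrArg Subtype.val h)
  have hD' : (0 : ℝ) ≤ D := Rat.cast_nonneg.2 hD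
  calc (D : ℝ) ≤ D * ‖σ x‖ := le_mul_of_one_le_right hD' hσ
    _ = ‖σ (∑ i, y i)‖ := by
      rw [hsum, map_mul, map_ratCast, norm_mul, Complex.norm_ratCast, abs_of_nonneg hD']
    _ ≤ ∑ i, ‖σ (y i)‖ := by
      rw [map_sum]
      exact norm_sum_le _ _
    _ ≤ Fintype.card ι • B := Finset.sum_le_card_nsmul _ _ _ fun i _ => hy i σ
    _ = Fintype.card ι * B := nsmul_eq_mul _ _

theorem IsRootSum.le_mul {a N n : ℕ} (ha : a ≠ 0) {D : ℚ} (hD : 0 ≤ D) {x : ℂ} (hx : x ≠ 0)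
    (hint : IsIntegral ℤ x) (h : IsRootSum a N n (D * x)) : (D : ℝ) ≤ n * a := by
  obtain ⟨z, hz, hsum⟩ := h
  have hpow (i : Fin n) : ∃ m j : ℕ, m ≠ 0 ∧ j ≤ m ∧ z i ^ m = (a : ℂ) ^ j := by
    obtain ⟨m, j, hm, hj, h⟩ := (isRootTerm_iff ha).1 (hz i)
    exact ⟨N * m, j * m, mul_ne_zero (by omega) hm.ne', Nat.mul_le_mul_right m hj.le, h⟩
  let S : Set ℂ := insert x (Set.range z)
  have hS : ∀ y ∈ S, IsIntegral ℚ y := by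
    rintro y (rfl | ⟨i, rfl⟩)
    · exact hint.tower_top
    · obtain ⟨m, j, hm, -, hzm⟩ := hpow i
      exact IsIntegral.of_pow (Nat.pos_of_ne_zero hm) (hzm ▸ (isIntegral_natCast a).pow j)
  let E := IntermediateField.adjoin ℚ S
  have : FiniteDimensional ℚ E :=
    have : Finite S := ((Set.finite_range z).insert x).to_subtype
    IntermediateField.finiteDimensional_adjoin hS
  have : NumberField E := ⟨⟩
  let x' : E := ⟨x, IntermediateField.subset_adjoin _ _ (Set.mem_insert _ _)⟩
  let z' (i : Fin n) : E :=
    ⟨z i, IntermediateField.subset_adjoin _ _ (Set.mem_insert_of_mem _ ⟨i, rfl⟩)⟩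
  have hbound (i : Fin n) (σ : E →+* ℂ) : ‖σ (z' i)‖ ≤ a := by
    obtain ⟨m, j, hm, hj, hzm⟩ := hpow i
    exact norm_map_le_of_pow_eq_pow σ ha hm hj (Subtype.ext (by simpa [z'] using hzm))
  have hint' : IsIntegral ℤ x' :=
    (isIntegral_algHom_iff (IsScalarTower.toAlgHom ℤ E ℂ) Subtype.val_injective).1 hint
  have hsum' : ∑ i, z' i = D * x' := Subtype.ext (by simpa [z', x'] using hsum)
  have hx' : x' ≠ 0 := fun h => hx (congrArg Subtype.val h)
  simpa using le_card_mul_of_sum_eq_mul hD hx' hint' hbound hsum'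

end Conjugates

section Norm

variable {K : Type*} [Field K] [NumberField K]

theorem one_le_abs_norm {x : K} (hx : x ≠ 0) (hint : IsIntegral ℤ x) :
    1 ≤ |Algebra.norm ℚ x| := by
  obtain ⟨n, hn⟩ := IsIntegrallyClosed.isIntegral_iff.1 (Algebra.isIntegral_norm ℚ hint)
  have hne : Algebra.norm ℚ x ≠ 0 := Algebra.norm_ne_zero_iff.2 hx
  rw [← hn, algebraMap_int_eq, eq_intCast] at hne ⊢
  rw [← Int.cast_abs]
  exact_mod_cast Int.one_le_abs (Int.cast_ne_zero.1 hne)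

theorem abs_norm_intCast (d : ℤ) :
    |Algebra.norm ℚ (d : K)| = (|d| : ℚ) ^ Module.finrank ℚ K := by
  rw [← map_intCast (algebraMap ℚ K), Algebra.norm_algebraMap, abs_pow]

end Norm

section Delta

variable {a N : ℕ} [NeZero a]

theorem coprime_towerIndex_zero {q : ℕ} (hq : q.Prime) : q.Coprime (towerIndex N q 0) := by
  rw [hq.coprime_iff_not_dvd, towerIndex, pow_zero, one_mul, hq.prime.dvd_finsetProd_iff]
  rintro ⟨r, hr, hdvd⟩
  obtain ⟨hrN, hrq⟩ := Finset.mem_filter.1 hr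
  exact hrq.ne' ((Nat.prime_dvd_prime_iff_eq hq (Nat.prime_of_mem_primeFactors hrN)).1
    (hq.dvd_of_dvd_pow hdvd))

theorem stepDisc_eq_kummerDisc (q : N.primeFactors) (t : Fin (N.factorization q))
    (ht : (t : ℕ) = 0) (hne : stepDisc a N q t ≠ 0) : stepDisc a N q t = kummerDisc a q := by
  have hq := Nat.prime_of_mem_primeFactors q.2
  obtain ⟨t, htlt⟩ := t
  obtain rfl : t = 0 := ht
  unfold stepDisc at hne ⊢
  rw [if_pos rfl] at hne ⊢
  refine relDisc_eq_kummerDisc (NeZero.ne a) (towerIndex_ne_zero q.2 (Nat.zero_le _)) hq.one_lt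
    (coprime_towerIndex_zero hq) (towerIndex_succ N q 0) _ ?_ ?_ hne
  · simpa [stdRoot] using Complex.isPrimitiveRoot_exp _ hq.ne_zero
  · simpa using realRoot_one_pow (a := a) hq.ne_zero

theorem isIntegral_stepDisc (q : N.primeFactors) (t : Fin (N.factorization q)) :
    IsIntegral ℤ (stepDisc a N q t) := by
  have hpow : (q : ℕ) ^ ((t : ℕ) + 1) ≠ 0 :=
    pow_ne_zero _ (Nat.prime_of_mem_primeFactors q.2).ne_zero
  have := finiteDimensional_kummerField a (towerIndex_ne_zero q.2 (Nat.succ_le_of_lt t.2))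
  have hint {L : IntermediateField ℚ ℂ} {z : L} {n : ℕ} (hn : n ≠ 0) {c : ℕ}
      (h : (z : ℂ) ^ n = c) : IsIntegral ℤ z :=
    IsIntegral.of_pow (Nat.pos_of_ne_zero hn)
      ((Subtype.ext (by simpa using h) : z ^ n = (c : L)) ▸ isIntegral_natCast c)
  exact isIntegral_relDisc _ (hint hpow (c := 1) (by rw [stdRoot_pow hpow, Nat.cast_one]))
    (hint hpow (realRoot_one_pow hpow))

variable (a N) in
/-- The contribution of one step of the tower to `kummerDelta`: the absolute value of the norm
of its discriminant. -/
noncomputable def stepNorm (q : N.primeFactors) (t : Fin (N.factorization q)) : ℚ :=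
  |Algebra.norm ℚ (IntermediateField.inclusion
    (kummerField_le (Nat.mem_primeFactors.1 q.2).2.2 (towerIndex_dvd q.2 t.2.le))
      (stepDisc a N q t))|

theorem kummerDelta_eq_prod (ha : a ≠ 1) :
    kummerDelta a N = ∏ q : N.primeFactors, ∏ t : Fin (N.factorization q), stepNorm a N q t := by
  rw [kummerDelta, if_neg ha]
  simp only [map_prod, Finset.abs_prod]
  rfl

theorem stepNorm_ne_zero_of_kummerDelta_ne_zero (ha : a ≠ 1) (hΔ : kummerDelta a N ≠ 0)
    (q : N.primeFactors) (t : Fin (N.factorization q)) : stepNorm a N q t ≠ 0 := by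
  rw [kummerDelta_eq_prod ha] at hΔ
  exact Finset.prod_ne_zero_iff.1 (Finset.prod_ne_zero_iff.1 hΔ q (Finset.mem_univ _)) t
    (Finset.mem_univ _)

theorem stepDisc_ne_zero_of_stepNorm_ne_zero {q : N.primeFactors} {t : Fin (N.factorization q)}
    (h : stepNorm a N q t ≠ 0) : stepDisc a N q t ≠ 0 := by
  have := finiteDimensional_kummerField a (Nat.mem_primeFactors.1 q.2).2.2
  contrapose h
  rw [stepNorm, h, map_zero, Algebra.norm_zero, abs_zero]

theorem one_le_stepNorm {q : N.primeFactors} {t : Fin (N.factorization q)}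
    (h : stepNorm a N q t ≠ 0) : 1 ≤ stepNorm a N q t := by
  have := finiteDimensional_kummerField a (Nat.mem_primeFactors.1 q.2).2.2
  have : NumberField (kummerField a N) := ⟨⟩
  exact one_le_abs_norm ((map_ne_zero _).2 (stepDisc_ne_zero_of_stepNorm_ne_zero h))
    ((isIntegral_stepDisc q t).map (IntermediateField.inclusion _))

theorem stepNorm_eq_pow {q : N.primeFactors} {t : Fin (N.factorization q)} (ht : (t : ℕ) = 0)
    (h : stepNorm a N q t ≠ 0) :
    stepNorm a N q t = (|kummerDisc a q| : ℚ) ^ Module.finrank ℚ (kummerField a N) := by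
  have := finiteDimensional_kummerField a (Nat.mem_primeFactors.1 q.2).2.2
  have : NumberField (kummerField a N) := ⟨⟩
  rw [stepNorm, stepDisc_eq_kummerDisc q t ht (stepDisc_ne_zero_of_stepNorm_ne_zero h),
    map_intCast, abs_norm_intCast]

theorem four_mul_pow_le_stepNorm {q : N.primeFactors} {t : Fin (N.factorization q)}
    (ht : (t : ℕ) = 0) (h : stepNorm a N q t ≠ 0) :
    (4 * (a : ℚ)) ^ Module.finrank ℚ (kummerField a N) ≤ stepNorm a N q t := by
  have hdisc : kummerDisc a q ≠ 0 := by
    have := stepDisc_ne_zero_of_stepNorm_ne_zero h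
    rw [stepDisc_eq_kummerDisc q t ht this] at this
    exact Int.cast_ne_zero.1 this
  have hle : 4 * (a : ℚ) ≤ |(kummerDisc a q : ℚ)| := by
    exact_mod_cast four_mul_le_abs_kummerDisc (Nat.pos_of_neZero a)
      (Nat.prime_of_mem_primeFactors q.2).one_lt hdisc
  rw [stepNorm_eq_pow ht h]
  gcongr

end Delta

section Scale

variable {a p N₁ : ℕ} [NeZero a] (ha : a ≠ 1) (hN : p * N₁ ≠ 0) {ζ ρ : ℂ}
  (hζ : IsPrimitiveRoot ζ p) (hρ : ρ ^ p = (a : ℂ))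

section

include ha

theorem relDisc_ne_zero_of_kummerScale_ne_zero (hr : kummerScale a p N₁ hN ζ ρ hζ hρ ≠ 0) :
    relDisc (kummerField a N₁) (kummerField a (p * N₁))
      (kummerField_le hN (Dvd.intro_left p rfl)) (p - 1) p
      ⟨ζ, mem_kummerField_of_pow_eq_one (NeZero.ne a) hN (Dvd.intro N₁ rfl) hζ.pow_eq_one⟩
      ⟨ρ, mem_kummerField_of_pow_eq hN (Dvd.intro N₁ rfl) hρ⟩ ≠ 0 := by
  have := finiteDimensional_kummerField a hN
  contrapose hr
  rw [kummerScale, if_neg ha, hr, map_zero, Algebra.norm_zero, abs_zero, div_zero]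

theorem mul_le_finrank_of_kummerScale_ne_zero (hr : kummerScale a p N₁ hN ζ ρ hζ hρ ≠ 0) :
    (p - 1) * p ≤ Module.finrank ℚ (kummerField a (p * N₁)) :=
  have := finiteDimensional_kummerField a hN
  mul_le_finrank_of_relDisc_ne_zero _ (relDisc_ne_zero_of_kummerScale_ne_zero ha hN hζ hρ hr)

theorem kummerScale_eq_inv_pow (hp : 1 < p) (hpN : p.Coprime N₁)
    (hr : kummerScale a p N₁ hN ζ ρ hζ hρ ≠ 0) :
    kummerScale a p N₁ hN ζ ρ hζ hρ =
      ((|kummerDisc a p| : ℚ) ^ Module.finrank ℚ (kummerField a (p * N₁)))⁻¹ := by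
  have := finiteDimensional_kummerField a hN
  have : NumberField (kummerField a (p * N₁)) := ⟨⟩
  rw [kummerScale, if_neg ha, relDisc_eq_kummerDisc (NeZero.ne a) (right_ne_zero_of_mul hN) hp hpN
    rfl _ hζ hρ (relDisc_ne_zero_of_kummerScale_ne_zero ha hN hζ hρ hr), map_intCast,
    abs_norm_intCast, one_div]

end

variable (hp : p.Prime) (hpN : ¬ p ∣ N₁)
include hp hpN

theorem kummerDelta_mul_kummerScale_eq_prod (ha : a ≠ 1) (hΔ : kummerDelta a (p * N₁) ≠ 0)
    (hr : kummerScale a p N₁ hN ζ ρ hζ hρ ≠ 0) :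
    kummerDelta a (p * N₁) * kummerScale a p N₁ hN ζ ρ hζ hρ =
      ∏ q ∈ Finset.univ.erase (⟨p, Nat.mem_primeFactors.2 ⟨hp, Dvd.intro N₁ rfl, hN⟩⟩ :
        (p * N₁).primeFactors), ∏ t, stepNorm a (p * N₁) q t := by
  set P : (p * N₁).primeFactors := ⟨p, Nat.mem_primeFactors.2 ⟨hp, Dvd.intro N₁ rfl, hN⟩⟩
  have hfac : (p * N₁).factorization p = 1 := by
    rw [Nat.factorization_mul hp.ne_zero (right_ne_zero_of_mul hN), Finsupp.add_apply,
      hp.factorization_self, Nat.factorization_eq_zero_of_not_dvd hpN]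
  have : Subsingleton (Fin ((p * N₁).factorization P)) := Fin.subsingleton_iff_le_one.2 hfac.le
  let t₀ : Fin ((p * N₁).factorization P) := ⟨0, hfac.ge⟩
  have hne : stepNorm a (p * N₁) P t₀ ≠ 0 := stepNorm_ne_zero_of_kummerDelta_ne_zero ha hΔ P t₀
  rw [kummerScale_eq_inv_pow ha hN hζ hρ hp.one_lt ((hp.coprime_iff_not_dvd).2 hpN) hr,
    ← stepNorm_eq_pow (q := P) (t := t₀) rfl hne, kummerDelta_eq_prod ha,
    ← Finset.mul_prod_erase _ _ (Finset.mem_univ P), Fintype.prod_subsingleton _ t₀, mul_comm,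
    inv_mul_cancel_left₀ hne]

theorem four_mul_pow_le_kummerDelta_mul_kummerScale (ha : a ≠ 1) (hN₁ : N₁ ≠ 1)
    (hΔ : kummerDelta a (p * N₁) ≠ 0) (hr : kummerScale a p N₁ hN ζ ρ hζ hρ ≠ 0) :
    (4 * (a : ℚ)) ^ ((p - 1) * p) ≤
      kummerDelta a (p * N₁) * kummerScale a p N₁ hN ζ ρ hζ hρ := by
  obtain ⟨q, hq, hqN⟩ := Nat.exists_prime_and_dvd hN₁
  have hqpN : q ∣ p * N₁ := dvd_mul_of_dvd_right hqN p
  let Q : (p * N₁).primeFactors := ⟨q, Nat.mem_primeFactors.2 ⟨hq, hqpN, hN⟩⟩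
  let t₀ : Fin ((p * N₁).factorization Q) := ⟨0, hq.factorization_pos_of_dvd hN hqpN⟩
  have hQ : (Q : ℕ) ≠ p := fun h => hpN (h ▸ hqN)
  have hne := stepNorm_ne_zero_of_kummerDelta_ne_zero ha hΔ
  have hstep (r t) : 1 ≤ stepNorm a (p * N₁) r t := one_le_stepNorm (hne r t)
  have hprod (r) : 1 ≤ ∏ t, stepNorm a (p * N₁) r t := Finset.one_le_prod fun t _ => hstep r t
  have ha' : (1 : ℚ) ≤ 4 * a := by
    have : (1 : ℚ) ≤ a := Nat.one_le_cast.2 (NeZero.one_le)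
    linarith
  rw [kummerDelta_mul_kummerScale_eq_prod hN hζ hρ hp hpN ha hΔ hr]
  calc (4 * (a : ℚ)) ^ ((p - 1) * p)
      ≤ (4 * (a : ℚ)) ^ Module.finrank ℚ (kummerField a (p * N₁)) :=
        pow_le_pow_right₀ ha' (mul_le_finrank_of_kummerScale_ne_zero ha hN hζ hρ hr)
    _ ≤ stepNorm a (p * N₁) Q t₀ := four_mul_pow_le_stepNorm rfl (hne _ _)
    _ ≤ ∏ t, stepNorm a (p * N₁) Q t := by
      rw [← Finset.mul_prod_erase _ _ (Finset.mem_univ t₀)]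
      exact le_mul_of_one_le_right (abs_nonneg _) (Finset.one_le_prod fun t _ => hstep Q t)
    _ ≤ _ := by
      rw [← Finset.mul_prod_erase _ _
        (Finset.mem_erase.2 ⟨fun h => hQ (congrArg Subtype.val h), Finset.mem_univ Q⟩)]
      exact le_mul_of_one_le_right (zero_le_one.trans (hprod Q))
        (Finset.one_le_prod fun r _ => hprod r)

theorem kummerDelta_mul_kummerScale_eq_one (h : a = 1 ∨ N₁ = 1)
    (hΔ : kummerDelta a (p * N₁) ≠ 0) (hr : kummerScale a p N₁ hN ζ ρ hζ hρ ≠ 0) :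
    kummerDelta a (p * N₁) * kummerScale a p N₁ hN ζ ρ hζ hρ = 1 := by
  by_cases ha : a = 1
  · rw [kummerDelta, kummerScale, if_pos ha, if_pos ha, one_mul]
  · obtain rfl : N₁ = 1 := h.resolve_left ha
    rw [kummerDelta_mul_kummerScale_eq_prod hN hζ hρ hp hpN ha hΔ hr]
    refine Finset.prod_eq_one fun q hq => absurd (Subtype.ext ?_) (Finset.ne_of_mem_erase hq)
    have hqp := Nat.mem_primeFactors.1 q.2
    exact (Nat.prime_dvd_prime_iff_eq hqp.1 hp).1 (by simpa using hqp.2.1)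

-- Otherwise `(4 * a) ^ (p * (p - 1)) ≤ Δ * r ≤ n * a`, whereas `n < 4 ^ (p * (p - 1))`.
theorem eq_one_or_eq_one_of_isRootSum {n : ℕ} {x : ℂ} (hint : IsIntegral ℤ x)
    (hx : ((kummerDelta a (p * N₁) * kummerScale a p N₁ hN ζ ρ hζ hρ : ℚ) : ℂ) * x ≠ 0)
    (h : IsRootSum a (p * N₁) n
      (((kummerDelta a (p * N₁) * kummerScale a p N₁ hN ζ ρ hζ hρ : ℚ) : ℂ) * x))
    (hn : Real.log n ≤ (p : ℝ) * ((p : ℝ) - 1)) : a = 1 ∨ N₁ = 1 := by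
  by_contra! hne
  have hD : kummerDelta a (p * N₁) * kummerScale a p N₁ hN ζ ρ hζ hρ ≠ 0 :=
    Rat.cast_ne_zero.1 (left_ne_zero_of_mul hx)
  have hge := four_mul_pow_le_kummerDelta_mul_kummerScale hN hζ hρ hp hpN hne.1 hne.2
    (left_ne_zero_of_mul hD) (right_ne_zero_of_mul hD)
  have hle := h.le_mul (NeZero.ne a) ((by positivity : (0 : ℚ) ≤ _).trans hge)
    (right_ne_zero_of_mul hx) hint
  have hd : (p - 1) * p ≠ 0 := mul_ne_zero (Nat.sub_ne_zero_of_lt hp.one_lt) hp.ne_zero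
  have hlt : (n : ℝ) < 4 ^ ((p - 1) * p) := calc
    (n : ℝ) ≤ Real.exp (Real.log n) := Real.le_exp_log _
    _ ≤ Real.exp (((p - 1) * p : ℕ) * 1) := by
      rw [mul_one, Nat.cast_mul, Nat.cast_pred hp.pos, mul_comm ((p : ℝ) - 1)]
      exact Real.exp_le_exp.2 hn
    _ = Real.exp 1 ^ ((p - 1) * p) := Real.exp_nat_mul _ _
    _ < 4 ^ ((p - 1) * p) := pow_lt_pow_left₀ (Real.exp_one_lt_d9.trans (by norm_num))
      (Real.exp_pos 1).le hd
  have ha : (1 : ℝ) ≤ a := Nat.one_le_cast.2 NeZero.one_le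
  refine lt_irrefl ((4 * (a : ℝ)) ^ ((p - 1) * p)) ?_
  calc (4 * (a : ℝ)) ^ ((p - 1) * p)
      ≤ ((kummerDelta a (p * N₁) * kummerScale a p N₁ hN ζ ρ hζ hρ : ℚ) : ℝ) := by
        exact_mod_cast hge
    _ ≤ n * a := hle
    _ < 4 ^ ((p - 1) * p) * a ^ ((p - 1) * p) :=
      mul_lt_mul hlt (le_self_pow₀ ha hd) (by positivity) (by positivity)
    _ = (4 * (a : ℝ)) ^ ((p - 1) * p) := (mul_pow ..).symm

end Scale

section Main

theorem kummerDelta_eq_one {a N : ℕ} [NeZero a] (h : a = 1 ∨ N = 1) : kummerDelta a N = 1 := by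
  by_cases ha : a = 1
  · rw [kummerDelta, if_pos ha]
  · obtain rfl : N = 1 := h.resolve_left ha
    have : IsEmpty (1 : ℕ).primeFactors := ⟨fun q => by simpa using q.2⟩
    rw [kummerDelta_eq_prod ha, Fintype.prod_empty]

theorem IsRootTerm.exists_pow_eq_one {a N : ℕ} (h : a = 1 ∨ N = 1) (ha : a ≠ 0) {z : ℂ}
    (hz : IsRootTerm a N z) : ∃ n, 0 < n ∧ z ^ n = 1 := by
  obtain ⟨m, j, hm, hj, hzm⟩ := (isRootTerm_iff ha).1 hz
  refine ⟨N * m, mul_pos (by omega) hm, hzm.trans ?_⟩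
  rcases h with rfl | rfl
  · rw [Nat.cast_one, one_pow]
  · obtain rfl : j = 0 := by omega
    rw [zero_mul, pow_zero]

theorem isRootTerm_mul_pow_mul_pow {a p N₁ n : ℕ} (ha : a ≠ 0) (hN : p * N₁ ≠ 0) {ζ ρ z : ℂ}
    (hζ : ζ ^ p = 1) (hρ : ρ ^ p = a) (hn : 0 < n) (hz : z ^ n = 1) (i : ℕ) {j : ℕ} (hj : j < p) :
    IsRootTerm a (p * N₁) (z * (ζ ^ i * ρ ^ j)) := by
  refine (isRootTerm_iff ha).2 ⟨n, j * N₁, hn,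
    Nat.mul_lt_mul_of_pos_right hj (Nat.pos_of_ne_zero (right_ne_zero_of_mul hN)), ?_⟩
  calc (z * (ζ ^ i * ρ ^ j)) ^ (p * N₁ * n)
      = (z ^ n) ^ (p * N₁) * (ζ ^ p) ^ (i * N₁ * n) * (ρ ^ p) ^ (j * N₁ * n) := by ring
    _ = (a : ℂ) ^ (j * N₁ * n) := by rw [hz, hζ, hρ, one_pow, one_pow, one_mul, one_mul]

theorem sum_pow_mul_pow_eq_zero {R : Type*} [CommRing R] [IsDomain R] {p : ℕ} (hp : 1 < p)
    {ζ : R} (hζ : IsPrimitiveRoot ζ p) (ρ : R) :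
    ∑ s : Fin p × Fin p, ζ ^ (s.1 : ℕ) * ρ ^ (s.2 : ℕ) = 0 := by
  rw [Fintype.sum_prod_type]
  simp only [← Finset.mul_sum, ← Finset.sum_mul]
  rw [Fin.sum_univ_eq_sum_range (fun i => ζ ^ i), hζ.geom_sum_eq_zero hp, zero_mul]

theorem isIntegral_sum_mul_pow_mul_pow {R : Type*} [CommRing R] {p : ℕ} {ζ ρ : R}
    (hζ : IsIntegral ℤ ζ) (hρ : IsIntegral ℤ ρ) {x : Fin p × Fin p → R}
    (hx : ∀ s, IsIntegral ℤ (x s)) :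
    IsIntegral ℤ (∑ s, x s * (ζ ^ (s.1 : ℕ) * ρ ^ (s.2 : ℕ))) :=
  .sum _ fun s _ => (hx s).mul ((hζ.pow _).mul (hρ.pow _))

theorem kummerDelta_mul_mem_span {a N : ℕ} [NeZero a] (h : a = 1 ∨ N = 1) (hN : N ≠ 0) {x : ℂ}
    (hx : x ∈ kummerField a N ∧ IsIntegral ℤ x) :
    ((kummerDelta a N : ℚ) : ℂ) * x ∈ Submodule.span ℤ {z | IsRootTerm a N z} := by
  rw [kummerDelta_eq_one h, Rat.cast_one, one_mul]
  exact mem_span_isRootTerm_of_isIntegral h hN hx.1 hx.2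

theorem kummerLength_sub_le {a N : ℕ} [NeZero a] (h : a = 1 ∨ N = 1) (hN : N ≠ 0) {ι : Type*}
    {x : ι → ℂ} (hx : ∀ s, x s ∈ kummerField a N ∧ IsIntegral ℤ (x s)) (s t u : ι) :
    kummerLength a N (x s - x u) ≤
      kummerLength a N (x s - x t) + kummerLength a N (x t - x u) := by
  have hsub (s t : ι) := kummerDelta_mul_mem_span h hN
    ⟨sub_mem (hx s).1 (hx t).1, (hx s).2.sub (hx t).2⟩
  rw [← sub_add_sub_cancel (x s) (x t) (x u)]
  exact kummerLength_add_le (hsub s t) (hsub t u)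

section

variable {a p N₁ : ℕ} [NeZero a] (hN : p * N₁ ≠ 0) {ζ ρ : ℂ} (hζ : IsPrimitiveRoot ζ p)
  (hρ : ρ ^ p = (a : ℂ)) (hp : p.Prime) (hpN : ¬ p ∣ N₁) {β : ℂ}

include hp hpN

theorem eq_one_or_eq_one_of_kummerLength_ne_zero {y : ℂ} (hy : IsIntegral ℤ y)
    (hβ : β = (kummerScale a p N₁ hN ζ ρ hζ hρ : ℚ) * y)
    (hT : kummerLength a (p * N₁) β ≠ 0)
    (hlog : Real.log (kummerLength a (p * N₁) β) ≤ (p : ℝ) * ((p : ℝ) - 1)) :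
    a = 1 ∨ N₁ = 1 := by
  have heq : ((kummerDelta a (p * N₁) : ℚ) : ℂ) * β =
      ((kummerDelta a (p * N₁) * kummerScale a p N₁ hN ζ ρ hζ hρ : ℚ) : ℂ) * y := by
    rw [hβ, Rat.cast_mul, mul_assoc]
  exact eq_one_or_eq_one_of_isRootSum hN hζ hρ hp hpN hy
    (heq ▸ mul_ne_zero_of_kummerLength_ne_zero hT)
    (heq ▸ isRootSum_of_kummerLength_ne_zero hT) hlog

theorem kummerLength_le_sum_sub_of_eq_one_or_eq_one (h : a = 1 ∨ N₁ = 1)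
    {x : Fin p × Fin p → ℂ} (hx : ∀ s, x s ∈ kummerField a N₁ ∧ IsIntegral ℤ (x s))
    (hβ : β = (kummerScale a p N₁ hN ζ ρ hζ hρ : ℚ) *
      ∑ s, x s * (ζ ^ (s.1 : ℕ) * ρ ^ (s.2 : ℕ)))
    (hT : kummerLength a (p * N₁) β ≠ 0) (s : Fin p × Fin p) :
    kummerLength a (p * N₁) β ≤ ∑ t, kummerLength a N₁ (x s - x t) := by
  have hne := mul_ne_zero_of_kummerLength_ne_zero hT
  have hone := kummerDelta_mul_kummerScale_eq_one hN hζ hρ hp hpN h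
    (Rat.cast_ne_zero.1 (left_ne_zero_of_mul hne))
    (Rat.cast_ne_zero.1 (left_ne_zero_of_mul (hβ ▸ right_ne_zero_of_mul hne)))
  refine kummerLength_le_sum_sub
    (fun t => kummerDelta_mul_mem_span h (right_ne_zero_of_mul hN) (hx t)) (fun t z hz => ?_)
    (sum_pow_mul_pow_eq_zero hp.one_lt hζ ρ) ?_ s
  · obtain ⟨n, hn, hzn⟩ := hz.exists_pow_eq_one h (NeZero.ne a)
    exact isRootTerm_mul_pow_mul_pow (NeZero.ne a) hN hζ.pow_eq_one hρ hn hzn _ t.2.2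
  · rw [hβ, ← mul_assoc, ← Rat.cast_mul, hone, kummerDelta_eq_one h]

end

theorem theorem4p4_general (k : ℝ) (hk : Real.log 2 < k) (c₁ : ℝ)
    (hc₁ : Real.exp (Real.exp 2) ≤ c₁) (hmono : MonotoneOn (loxtonG k c₁) (Set.Ici 0)) :
    ∃ c₅ : ℝ, 0 < c₅ ∧
      ∀ (a : ℕ) [NeZero a],
      ∀ (p N₁ : ℕ) (_ : p.Prime) (_ : ¬ p ∣ N₁) (hN : p * N₁ ≠ 0), c₅ ≤ (p : ℝ) →
      ∀ (ζ ρ : ℂ) (hζ : IsPrimitiveRoot ζ p) (hρ : ρ ^ p = (a : ℂ))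
        (α : Fin p → Fin p → ℂ),
        (∀ i j, α i j ∈ kummerField a N₁ ∧ IsIntegral ℤ (α i j)) →
      ∀ β : ℂ,
        β = ∑ i : Fin p, ∑ j : Fin p,
          (α i j * ((kummerScale a p N₁ hN ζ ρ hζ hρ : ℚ) : ℂ)) *
            ζ ^ (i : ℕ) * ρ ^ (j : ℕ) →
        Real.log (kummerLength a (p * N₁) β : ℝ) ≤ (p : ℝ) * ((p : ℝ) - 1) →
        2 * (p : ℝ) * ((p : ℝ) - 1) * loxtonG k c₁ (kummerLength a (p * N₁) β : ℝ) ≤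
          ∑ i : Fin p, ∑ j : Fin p, ∑ l : Fin p, ∑ m : Fin p,
            loxtonG k c₁ (kummerLength a N₁ (α i j - α l m) : ℝ) := by
  obtain ⟨n₀, hn₀⟩ := exists_forall_two_mul_card_sub_six_mul_loxtonG_le hk hc₁ hmono
  refine ⟨max n₀ 6, by positivity, fun a _ p N₁ hp hpN hN hcp ζ ρ hζ hρ α hα β hβ hlog => ?_⟩
  have hp6 : (6 : ℝ) ≤ p := (le_max_right _ _).trans hcp
  have hg (z : ℂ) (N : ℕ) : 0 ≤ loxtonG k c₁ (kummerLength a N z : ℝ) :=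
    loxtonG_nonneg (Nat.cast_nonneg _)
  by_cases hT : kummerLength a (p * N₁) β = 0
  · rw [hT, Nat.cast_zero, loxtonG_zero, mul_zero]
    exact Finset.sum_nonneg fun i _ => Finset.sum_nonneg fun j _ =>
      Finset.sum_nonneg fun l _ => Finset.sum_nonneg fun m _ => hg _ _
  let x (s : Fin p × Fin p) : ℂ := α s.1 s.2
  have hx (s : Fin p × Fin p) : x s ∈ kummerField a N₁ ∧ IsIntegral ℤ (x s) := hα s.1 s.2
  have hβx : β = (kummerScale a p N₁ hN ζ ρ hζ hρ : ℚ) *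
      ∑ s, x s * (ζ ^ (s.1 : ℕ) * ρ ^ (s.2 : ℕ)) := by
    rw [hβ, Fintype.sum_prod_type, Finset.mul_sum]
    simp only [Finset.mul_sum]
    exact Finset.sum_congr rfl fun i _ => Finset.sum_congr rfl fun j _ => by ring
  have h := eq_one_or_eq_one_of_kummerLength_ne_zero hN hζ hρ hp hpN
    (isIntegral_sum_mul_pow_mul_pow (hζ.isIntegral hp.pos)
      (.of_pow hp.pos (hρ ▸ isIntegral_natCast a)) fun s => (hx s).2) hβx hT hlog
  have hcard : (Fintype.card (Fin p × Fin p) : ℝ) = p * p := by simp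
  have hmetric := hn₀ (Fin p × Fin p) (by nlinarith [(le_max_left n₀ 6).trans hcp])
    (fun s t => kummerLength a N₁ (x s - x t)) (fun s t => kummerLength_sub_comm _ _)
    (kummerLength_sub_le h (right_ne_zero_of_mul hN) hx) _
    (kummerLength_le_sum_sub_of_eq_one_or_eq_one hN hζ hρ hp hpN h hx hβx hT)
    (by nlinarith)
  rw [hcard] at hmetric
  simp only [Fintype.sum_prod_type] at hmetric
  exact (mul_le_mul_of_nonneg_right (by linarith) (hg β _)).trans hmetric

end Main

theorem theorem4p4 (k : ℝ) (hk : Real.log 2 < k) (c₁ : ℝ) (hc₁ : IsLoxtonConst k c₁) :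
    ∃ c₅ : ℝ, 0 < c₅ ∧
      ∀ (a : ℕ) [NeZero a],
        (a = 1 ∨ ∀ (b : ℚ) (m : ℕ), 2 ≤ m → (a : ℚ) ≠ b ^ m) →
      ∀ (p N₁ : ℕ) (_ : p.Prime) (_ : ¬ p ∣ N₁) (hN : p * N₁ ≠ 0), c₅ ≤ (p : ℝ) →
      ∀ (ζ ρ : ℂ) (hζ : IsPrimitiveRoot ζ p) (hρ : ρ ^ p = (a : ℂ))
        (α : Fin p → Fin p → ℂ),
        (∀ i j, α i j ∈ kummerField a N₁ ∧ IsIntegral ℤ (α i j)) →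
      ∀ β : ℂ,
        β = ∑ i : Fin p, ∑ j : Fin p,
          (α i j * ((kummerScale a p N₁ hN ζ ρ hζ hρ : ℚ) : ℂ)) *
            ζ ^ (i : ℕ) * ρ ^ (j : ℕ) →
        Real.log (kummerLength a (p * N₁) β : ℝ) ≤ (p : ℝ) * ((p : ℝ) - 1) →
        2 * (p : ℝ) * ((p : ℝ) - 1) * loxtonG k c₁ (kummerLength a (p * N₁) β : ℝ) ≤
          ∑ i : Fin p, ∑ j : Fin p, ∑ l : Fin p, ∑ m : Fin p,
            loxtonG k c₁ (kummerLength a N₁ (α i j - α l m) : ℝ) := by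
  obtain ⟨c₅, hc₅, h⟩ := theorem4p4_general k hk c₁ hc₁.exp_exp_two_le hc₁.monotoneOn
  exact ⟨c₅, hc₅, fun a _ _ => h a⟩
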